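/- Let $P=(p_n)_{n\ge1}$ and $Q=(q_n)_{n\ge1}$ be sequences of integers with $p_n,q_n\ge 2$. The $Q$-Cantor series expansion of a real $x$ is the unique expansion $x=\lfloor x\rfloor+\sum_{n\ge1}\frac{E_n}{q_1\cdots q_n}$ with $E_n\in\{0,\dots,q_n-1\}$ and $E_n\ne q_n-1$ for infinitely many $n$; the $P$-expansion is defined in the same way. Let $\mathscr U_Q$ be the set of reals with $E_n\neq0$ for infinitely many $n$ (the points with a unique $Q$-expansion). If $F_1,F_2,\dots$ are the $P$-digits of $x$, put $\psi_{P,Q}(x)=\sum_{n\ge1}\frac{\min(F_n,q_n-1)}{q_1\cdots q_n}$. For $w\in(0,1)$, with $Q$-digits $E_1,E_2,\dots$, let $L_{P,Q}(w)=\{x\in(0,1):\psi_{P,Q}(x)=w\}$, and set $\omega_n(w)=0$ if $E_n\ge p_n$; otherwise $\omega_n(w)=1$ if $E_n\le q_n-2$ and $\omega_n(w)=p_n-q_n+1$ if $E_n=q_n-1$. Write $\lambda$ for Lebesgue measure and $\dim_H,\dim_P$ for Hausdorff and packing dimension, the box dimension $\dim_B$ being said to exist if the lower and upper box dimensions agree;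 $\dim_P S$ is the infimum of $\sup_i\overline{\dim}_B S_i$ over all countable covers $S\subseteq\bigcup_i S_i$. Consider the condition $$(\ast)\qquad \lim_{n\to\infty}\frac{\log p_n}{\log(p_1\cdots p_n)}=0 .$$ **Theorem.** Let $w\in(0,1)$. The set $L_{P,Q}(w)$ is Borel, and the following hold. 1. If $w\in\mathscr U_Q$, then $\lambda(L_{P,Q}(w))=\prod_{j=1}^\infty\frac{\omega_j(w)}{p_j}$, and if moreover $(\ast)$ holds, then $$\dim_H L_{P,Q}(w)=\liminf_{n\to\infty}\frac{\log\prod_{j=1}^n\omega_j(w)}{\log\prod_{j=1}^n p_j}.$$ (If some $\omega_j(w)=0$, both sides of the last formula are read as $0$: $\dim_H\emptyset=0$ and $\log 0=0$.) 2. Suppose that $w\notin\mathscr U_Q$, let $M=\max\{t:E_t>0\}$, and suppose that $p_n\ge q_n$ for all $n>M$ and that $E_M\le p_M$. Then $$\lambda(L_{P,Q}(w))=\Big(\prod_{j=1}^{M-1}\frac{\omega_j(w)}{p_j}\Big)\cdot\frac1{p_M}\cdot\prod_{j=M+1}^\infty\frac{p_j-q_j+1}{p_j}.$$ If moreover $E_j<p_j$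 for all $j<M$ and $(\ast)$ holds, then $$\dim_H L_{P,Q}(w)=\liminf_{n\to\infty}\frac{\log\prod_{j=M+1}^n(p_j-q_j+1)}{\log\prod_{j=M+1}^n p_j}.$$ 3. Let $D_n=E_n$ for all $n$ if $w\in\mathscr U_Q$; if $w\notin\mathscr U_Q$ and $M=\max\{t:E_t>0\}$, let $D_n=E_n$ for $n<M$, $D_M=E_M-1$, and $D_n=q_n-1$ for $n>M$. Let $I_n=\{D_n\}$ if $D_n\le q_n-2$ and $I_n=\{q_n-1,\dots,p_n-1\}$ if $D_n=q_n-1$. If $L_{P,Q}(w)\neq\emptyset$ and $$\liminf_{n\to\infty}\frac{\log\prod_{j=1}^n|I_j|}{\log\prod_{j=1}^{n+1}p_j-\log|I_{n+1}|}=\limsup_{n\to\infty}\frac{\log\prod_{j=1}^{n+1}|I_j|}{\log\prod_{j=1}^{n}p_j+\log|I_{n+1}|},$$ then the box dimension of $L_{P,Q}(w)$ exists and $\dim_H L_{P,Q}(w)=\dim_P L_{P,Q}(w)=\dim_B L_{P,Q}(w)$. -/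

import Mathlib

open Filter Topology MeasureTheory Set
open scoped ENNReal NNReal

namespace CantorSeries

/-! Sequences are indexed from `0`: the value at `n : ℕ` of a basic sequence or of a digit sequence
is the entry which is usually written with the index `n + 1`. -/

/-- A basic sequence: a sequence of integers that are at least `2`. -/
def IsBasic (q : ℕ → ℕ) : Prop := ∀ n, 2 ≤ q n

/-- The product of the first `n` terms of `q`. -/
def partialProd (q : ℕ → ℕ) (n : ℕ) : ℕ := ∏ j ∈ Finset.range n, q j

/-- `E` is the sequence of fractional digits of the `q`-Cantor series expansion of `x`, the
integer digit being `⌊x⌋`. -/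
def IsExpansion (q : ℕ → ℕ) (x : ℝ) (E : ℕ → ℕ) : Prop :=
  (∀ n, E n < q n) ∧ (∃ᶠ n in atTop, E n ≠ q n - 1) ∧
    HasSum (fun n => (E n : ℝ) / partialProd q (n + 1)) (x - ⌊x⌋)

/-- The fractional digits of the `q`-Cantor series expansion of `x`; see `isExpansion_iff`. -/
noncomputable def digit (q : ℕ → ℕ) (x : ℝ) (n : ℕ) : ℕ :=
  (⌊x * partialProd q (n + 1)⌋ % (q n : ℤ)).toNat

theorem partialProd_succ (q : ℕ → ℕ) (n : ℕ) :
    partialProd q (n + 1) = partialProd q n * q n := by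
  simp [partialProd, Finset.prod_range_succ]

theorem partialProd_pos {q : ℕ → ℕ} (hq : IsBasic q) (n : ℕ) : 0 < partialProd q n :=
  Finset.prod_pos fun j _ => by have := hq j; omega

theorem two_pow_le_partialProd {q : ℕ → ℕ} (hq : IsBasic q) (n : ℕ) :
    2 ^ n ≤ partialProd q n := by
  induction n with
  | zero => simp [partialProd]
  | succ n ih => rw [partialProd_succ, pow_succ]; exact Nat.mul_le_mul ih (hq n)

theorem tendsto_inv_partialProd {q : ℕ → ℕ} (hq : IsBasic q) :
    Tendsto (fun n => (1 : ℝ) / partialProd q n) atTop (𝓝 0) := by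
  refine squeeze_zero (fun n => by positivity) (fun n => ?_)
    (tendsto_pow_atTop_nhds_zero_of_lt_one (r := (1 / 2 : ℝ)) (by norm_num) (by norm_num))
  rw [one_div_pow]
  have h : ((2 : ℝ) ^ n) ≤ partialProd q n := by exact_mod_cast two_pow_le_partialProd hq n
  exact one_div_le_one_div_of_le (by positivity) h

theorem floor_succ {q : ℕ → ℕ} (hq : IsBasic q) (x : ℝ) (n : ℕ) :
    ⌊x * partialProd q (n + 1)⌋ = q n * ⌊x * partialProd q n⌋ + (digit q x n : ℤ) := by
  have h2 := hq n
  have hq0 : (q n : ℤ) ≠ 0 := by omega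
  have hqr : (q n : ℝ) ≠ 0 := by exact_mod_cast hq0
  have hdiv : ⌊x * partialProd q n⌋ = ⌊x * partialProd q (n + 1)⌋ / (q n : ℤ) := by
    rw [← Int.floor_div_natCast]
    congr 1
    rw [partialProd_succ]; push_cast; field_simp
  have hd : (digit q x n : ℤ) = ⌊x * partialProd q (n + 1)⌋ % (q n : ℤ) :=
    Int.toNat_of_nonneg (Int.emod_nonneg _ hq0)
  rw [hd, hdiv]
  exact (Int.mul_ediv_add_emod _ _).symm

theorem isExpansion_digit {q : ℕ → ℕ} (hq : IsBasic q) (x : ℝ) :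
    IsExpansion q x (digit q x) := by
  have hpos : ∀ n, (0 : ℝ) < partialProd q n := fun n => by exact_mod_cast partialProd_pos hq n
  have hfl : ∀ n, (⌊x * partialProd q (n + 1)⌋ : ℝ)
      = q n * ⌊x * partialProd q n⌋ + (digit q x n : ℝ) := fun n => by
    exact_mod_cast floor_succ hq x n
  refine ⟨fun n => ?_, fun hev => ?_, ?_⟩
  · have h2 := hq n
    have h := Int.emod_lt_of_pos ⌊x * partialProd q (n + 1)⌋ (b := (q n : ℤ)) (by omega)
    unfold digit
    omega
  · simp only [not_not] at hev
    obtain ⟨N, hN⟩ := eventually_atTop.1 hev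
    set r : ℕ → ℝ := fun n => ⌊x * partialProd q n⌋ + 1 - x * partialProd q n with hr
    have hr0 : ∀ n, 0 < r n := fun n => by
      have := Int.lt_floor_add_one (x * partialProd q n); simp only [hr]; linarith
    have hr1 : ∀ n, r n ≤ 1 := fun n => by
      have := Int.floor_le (x * partialProd q n); simp only [hr]; linarith
    have hstep : ∀ n, N ≤ n → 2 * r n ≤ r (n + 1) := fun n hn => by
      have h2 : (2 : ℝ) ≤ q n := by exact_mod_cast hq n
      have hd : (digit q x n : ℝ) = q n - 1 := by
        rw [hN n hn, Nat.cast_sub (by have := hq n; omega)]; simp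
      have : r (n + 1) = q n * r n := by
        simp only [hr]
        rw [hfl n, hd, partialProd_succ]; push_cast; ring
      rw [this]; exact mul_le_mul_of_nonneg_right h2 (hr0 n).le
    have hpow : ∀ k, 2 ^ k * r N ≤ r (N + k) := fun k => by
      induction k with
      | zero => simp
      | succ k ih =>
        have := hstep (N + k) (by omega)
        rw [← add_assoc, pow_succ]; linarith
    obtain ⟨k, hk⟩ := pow_unbounded_of_one_lt (1 / r N) (one_lt_two)
    have h3 : 1 < 2 ^ k * r N := by rwa [div_lt_iff₀ (hr0 N)] at hk
    linarith [hpow k, hr1 (N + k)]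
  · rw [hasSum_iff_tendsto_nat_of_nonneg (fun n => by positivity)]
    have hsum : ∀ n, ∑ j ∈ Finset.range n, (digit q x j : ℝ) / partialProd q (j + 1)
        = ⌊x * partialProd q n⌋ / partialProd q n - ⌊x⌋ := fun n => by
      induction n with
      | zero => simp [partialProd]
      | succ n ih =>
        have h1 := (hpos n).ne'
        have h2 : (q n : ℝ) ≠ 0 := by have := hq n; positivity
        rw [Finset.sum_range_succ, ih, hfl n, partialProd_succ]
        push_cast; field_simp; ring
    simp only [hsum]
    refine Tendsto.sub_const ?_ _
    have hlow : Tendsto (fun n => x - (1 : ℝ) / partialProd q n) atTop (𝓝 x) := by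
      simpa using (tendsto_inv_partialProd hq).const_sub x
    refine tendsto_of_tendsto_of_tendsto_of_le_of_le hlow tendsto_const_nhds (fun n => ?_)
      (fun n => ?_)
    · have := Int.lt_floor_add_one (x * partialProd q n)
      have h1 := hpos n
      simp only
      rw [le_div_iff₀ h1, sub_mul, one_div_mul_cancel h1.ne']; linarith
    · have h1 := hpos n
      simp only
      rw [div_le_iff₀ h1]; exact Int.floor_le _

/-- Existence and uniqueness of the Cantor series expansion: `digit q x` is the only one. -/
theorem isExpansion_iff {q : ℕ → ℕ} (hq : IsBasic q) (x : ℝ) (E : ℕ → ℕ) :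
    IsExpansion q x E ↔ E = digit q x := by
  refine ⟨fun ⟨hlt, hfr, hs⟩ => ?_, fun h => h ▸ isExpansion_digit hq x⟩
  have hpos : ∀ n, (0 : ℝ) < partialProd q n := fun n => by exact_mod_cast partialProd_pos hq n
  set f : ℕ → ℝ := fun n => (E n : ℝ) / partialProd q (n + 1) with hf
  set g : ℕ → ℝ := fun n => ((q n : ℝ) - 1) / partialProd q (n + 1) with hg
  have hfg : ∀ n, f n ≤ g n := fun n => by
    refine div_le_div_of_nonneg_right ?_ (hpos _).le
    have : (E n : ℝ) + 1 ≤ q n := by exact_mod_cast hlt n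
    linarith
  have hg0 : ∀ n, 0 ≤ g n := fun n => (by simp only [hf]; positivity : 0 ≤ f n).trans (hfg n)
  have hgp : ∀ n, ∑ j ∈ Finset.range n, g j = 1 - 1 / partialProd q n := fun n => by
    induction n with
    | zero => simp [partialProd]
    | succ n ih =>
      have h1 := (hpos n).ne'
      have h2 : (q n : ℝ) ≠ 0 := by have := hq n; positivity
      rw [Finset.sum_range_succ, ih]
      simp only [hg, partialProd_succ]
      push_cast; field_simp; ring
  have hgs : HasSum g 1 := by
    rw [hasSum_iff_tendsto_nat_of_nonneg hg0]
    simp only [hgp]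
    simpa using (tendsto_inv_partialProd hq).const_sub 1
  have hA : ∀ n, ∃ A : ℤ, (∑ j ∈ Finset.range n, f j) * partialProd q n = A := fun n => by
    induction n with
    | zero => exact ⟨0, by simp⟩
    | succ n ih =>
      obtain ⟨A, hA⟩ := ih
      refine ⟨A * q n + E n, ?_⟩
      have h1 := (hpos (n + 1)).ne'
      rw [Finset.sum_range_succ, add_mul]
      simp only [hf]
      rw [div_mul_cancel₀ _ h1, partialProd_succ]
      push_cast
      rw [← hA]; ring
  have hfloor : ∀ n, (⌊x * partialProd q n⌋ : ℝ)
      = (⌊x⌋ + ∑ j ∈ Finset.range n, f j) * partialProd q n := fun n => by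
    obtain ⟨A, hA⟩ := hA n
    have hft : HasSum (fun k => f (k + n)) (x - ⌊x⌋ - ∑ j ∈ Finset.range n, f j) :=
      (hasSum_nat_add_iff' n).2 hs
    have hgt : HasSum (fun k => g (k + n)) (1 - ∑ j ∈ Finset.range n, g j) :=
      (hasSum_nat_add_iff' n).2 hgs
    obtain ⟨m, hm, hne⟩ := frequently_atTop.1 hfr n
    have hlt' : f m < g m := by
      refine div_lt_div_of_pos_right ?_ (hpos _)
      have h1 := hlt m
      have : (E m : ℝ) + 1 < q m := by exact_mod_cast (by omega : E m + 1 < q m)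
      linarith
    have hup : x - ⌊x⌋ - ∑ j ∈ Finset.range n, f j < 1 - ∑ j ∈ Finset.range n, g j := by
      refine hasSum_lt (i := m - n) (fun k => hfg (k + n)) ?_ hft hgt
      simpa [Nat.sub_add_cancel hm] using hlt'
    have hlo : 0 ≤ x - ⌊x⌋ - ∑ j ∈ Finset.range n, f j :=
      hft.nonneg fun k => by simp only [hf]; positivity
    rw [hgp n, sub_sub_cancel, lt_div_iff₀ (hpos n)] at hup
    have hlo' := mul_nonneg hlo (hpos n).le
    have key : ⌊x * partialProd q n⌋ = ⌊x⌋ * partialProd q n + A := by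
      rw [Int.floor_eq_iff]
      push_cast
      rw [← hA]
      constructor <;> nlinarith
    rw [key]
    push_cast
    rw [← hA]; ring
  funext n
  have h1 := hfloor (n + 1)
  have h2 : (⌊x * partialProd q (n + 1)⌋ : ℝ)
      = q n * ⌊x * partialProd q n⌋ + (digit q x n : ℝ) := by exact_mod_cast floor_succ hq x n
  rw [h2, hfloor n, Finset.sum_range_succ] at h1
  have h3 : f n * partialProd q (n + 1) = E n := div_mul_cancel₀ _ (hpos (n + 1)).ne'
  have h4 : (digit q x n : ℝ) = E n := by
    rw [← h3]
    rw [partialProd_succ] at h1 ⊢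
    push_cast at h1 ⊢
    linarith
  exact_mod_cast h4.symm

/-- The points whose `q`-Cantor series expansion has infinitely many nonzero digits: those that have
only one expansion. -/
def uniqueSet (q : ℕ → ℕ) : Set ℝ := {x | ∃ᶠ n in atTop, digit q x n ≠ 0}

/-- The function `ψ_{P,Q}`. -/
noncomputable def psi (p q : ℕ → ℕ) (x : ℝ) : ℝ :=
  ∑' n, (min (digit p x n) (q n - 1) : ℕ) / (partialProd q (n + 1) : ℝ)

/-- The level set of `ψ_{P,Q}` in `(0,1)` at the height `w`. -/
def levelSet (p q : ℕ → ℕ) (w : ℝ) : Set ℝ := {x | x ∈ Ioo 0 1 ∧ psi p q x = w}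

/-- The numbers `ω_n(w)`; the value `0` takes precedence when the digit is not less than `p n`. -/
noncomputable def omega (p q : ℕ → ℕ) (w : ℝ) (n : ℕ) : ℕ :=
  if p n ≤ digit q w n then 0
  else if digit q w n ≤ q n - 2 then 1
  else p n - q n + 1

open Classical in
/-- The digits of the expansion of `w ∈ (0,1)` that does not end in zeros. It is the
`q`-Cantor series expansion if `w` has only one expansion; otherwise, if `M` is the last position of
a nonzero digit, that digit is lowered by one and all later digits are `q n - 1`. -/
noncomputable def infDigit (q : ℕ → ℕ) (w : ℝ) (n : ℕ) : ℕ :=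
  if ∃ m > n, digit q w m ≠ 0 then digit q w n
  else if digit q w n ≠ 0 then digit q w n - 1
  else q n - 1

/-- The set of admissible `p`-digits at the position `n` of the points of the level set at `w`. -/
noncomputable def digitSet (p q : ℕ → ℕ) (w : ℝ) (n : ℕ) : Finset ℕ :=
  if infDigit q w n ≤ q n - 2 then {infDigit q w n} else Finset.Icc (q n - 1) (p n - 1)

/-- `log p_n / log (p_1 ⋯ p_n) → 0`. -/
def LogNegligible (p : ℕ → ℕ) : Prop :=
  Tendsto (fun n => Real.log (p n) / Real.log (partialProd p (n + 1))) atTop (𝓝 0)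

/-- The condition that
`log ∏_{j ≤ n} a_j / (log ∏_{j ≤ n+1} p_j - log a_{n+1})` and
`log ∏_{j ≤ n+1} a_j / (log ∏_{j ≤ n} p_j + log a_{n+1})`
have the lower limit of the first equal to the upper limit of the second. -/
def BalancedCounts (p a : ℕ → ℕ) : Prop :=
  liminf (fun n => ((Real.log (partialProd a n) /
      (Real.log (partialProd p (n + 1)) - Real.log (a n)) : ℝ) : EReal)) atTop =
    limsup (fun n => ((Real.log (partialProd a (n + 1)) /
      (Real.log (partialProd p n) + Real.log (a n)) : ℝ) : EReal)) atTop

end CantorSeries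

namespace FractalDim

variable {X : Type*} [PseudoEMetricSpace X]

/-- The quotient `log N_δ(s) / log (1/δ)`, where `N_δ(s)` is the least number of closed balls of
radius `δ` that cover `s`. It is `0` for `s = ∅`, and `∞` if `N_δ(s) = ∞` and `δ < 1`. -/
noncomputable def boxRatio (s : Set X) (δ : ℝ≥0) : ℝ≥0∞ :=
  (ENNReal.log (Metric.externalCoveringNumber δ s : ℝ≥0∞) /
    ENNReal.log (δ : ℝ≥0∞)⁻¹).toENNReal

/-- The lower box dimension. -/
noncomputable def lowerBoxDim (s : Set X) : ℝ≥0∞ := liminf (boxRatio s) (𝓝[>] 0)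

/-- The upper box dimension. -/
noncomputable def upperBoxDim (s : Set X) : ℝ≥0∞ := limsup (boxRatio s) (𝓝[>] 0)

/-- The packing dimension: the infimum, over all countable covers of `s`, of the supremum of the
upper box dimensions of the pieces. -/
noncomputable def packingDim (s : Set X) : ℝ≥0∞ :=
  ⨅ (F : ℕ → Set X) (_ : s ⊆ ⋃ i, F i), ⨆ i, upperBoxDim (F i)

end FractalDim

open CantorSeries FractalDim

namespace FractalDim

/-! The equation `psi p q x = w` says that the truncated `p`-digits of `x` form a `q`-expansion of
`w`. There are at most two such expansions, `digit q w` and `infDigit q w`. If they differ, the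
first ends in zeros and contributes only finitely many `x`. So, up to a finite set, the level set is
a `digitBox`: the `n`-th `p`-digit ranges independently over `a n` consecutive values
(`exists_levelSet_eq`). Finite sets affect neither measure nor any of the dimensions here. Write `A
n` and `P n` for the partial products of `a` and `p`.

Measure: the box is a decreasing intersection of unions of `A n` intervals of length `1 / P n`.

Hausdorff dimension: one ball of radius `a n / P (n + 1)` for each of the `A n` prefixes bounds it
above by the lower limit of `lowerRatio` (`dimH_digitBox_le_liminf`). For the converse, `lift` reads
the `a`-digits of `t` in `[0,1)` as shifted `p`-digits. Its inverse is Hölder with every positive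
exponent below that lower limit, and its image has dimension one (`le_dimH_digitBox`). The resulting
formula `dimH_digitBox` needs no growth condition; `LogNegligible` only replaces the denominator by
`log (P n)`.

Coincidence of dimensions: counting balls at all scales bounds the upper box dimension by the upper
limit of `upperRatio` (`upperBoxDim_digitBox_union_le`). When the two limits agree it is at most the
Hausdorff dimension, and the general inequalities between dimensions close the circle. -/

theorem tendsto_log_one_div_nhdsGT :
    Tendsto (fun δ : ℝ≥0 => Real.log (1 / (δ : ℝ))) (𝓝[>] 0) atTop := by
  have h1 : Tendsto (fun δ : ℝ≥0 => (δ : ℝ)) (𝓝[>] 0) (𝓝[>] 0) := by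
    refine tendsto_nhdsWithin_of_tendsto_nhds_of_eventually_within _ ?_ ?_
    · exact (NNReal.continuous_coe.tendsto' 0 0 rfl).mono_left nhdsWithin_le_nhds
    · filter_upwards [self_mem_nhdsWithin] with δ hδ using by exact_mod_cast hδ
  simp only [one_div]
  exact Real.tendsto_log_atTop.comp (tendsto_inv_nhdsGT_zero.comp h1)

/-! ### Box dimensions through covering numbers -/

section Box

variable {X : Type*} [PseudoEMetricSpace X]

theorem ennreal_log_inv_coe {δ : ℝ≥0} (h0 : 0 < δ) :
    ENNReal.log (δ : ℝ≥0∞)⁻¹ = (Real.log (1 / (δ : ℝ)) : ℝ) := by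
  rw [ENNReal.log_inv, ENNReal.log_of_nnreal h0.ne', one_div, Real.log_inv]
  simp

theorem boxRatio_le {s : Set X} {δ : ℝ≥0} {m : ℕ} (h0 : 0 < δ) (h1 : δ < 1) (hm : 1 ≤ m)
    (h : Metric.externalCoveringNumber δ s ≤ m) :
    boxRatio s δ ≤ ENNReal.ofReal (Real.log m / Real.log (1 / (δ : ℝ))) := by
  unfold boxRatio
  have hL : 0 < Real.log (1 / (δ : ℝ)) :=
    Real.log_pos (by rw [one_div]; exact (one_lt_inv₀ (by exact_mod_cast h0)).2 (by exact_mod_cast h1))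
  rw [ennreal_log_inv_coe h0, ← EReal.real_coe_toENNReal]
  refine EReal.toENNReal_le_toENNReal ?_
  have h2 : ENNReal.log (Metric.externalCoveringNumber δ s : ℝ≥0∞) ≤ (Real.log m : ℝ) := by
    have h3 : (Metric.externalCoveringNumber δ s : ℝ≥0∞) ≤ ((m : ℝ≥0) : ℝ≥0∞) := by
      simpa using ENat.toENNReal_le.2 h
    refine (ENNReal.log_monotone h3).trans ?_
    rw [ENNReal.log_of_nnreal (by positivity)]
    simp
  rw [EReal.coe_div]
  exact EReal.div_le_div_right_of_nonneg (by exact_mod_cast hL.le) h2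

theorem externalCoveringNumber_le_of_boxRatio_lt {s : Set X} {δ d : ℝ≥0} (h0 : 0 < δ) (h1 : δ < 1)
    (h : boxRatio s δ < d) :
    (Metric.externalCoveringNumber δ s : ℝ≥0∞) ≤ ((δ : ℝ≥0∞)⁻¹) ^ (d : ℝ) := by
  unfold boxRatio at h
  have hL : 0 < Real.log (1 / (δ : ℝ)) :=
    Real.log_pos (by rw [one_div]; exact (one_lt_inv₀ (by exact_mod_cast h0)).2 (by exact_mod_cast h1))
  rw [← ENNReal.log_le_log_iff, ENNReal.log_rpow, ennreal_log_inv_coe h0]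
  rw [ennreal_log_inv_coe h0] at h
  -- `toENNReal` cuts negative values off at zero, so it can only increase the quotient.
  have h2 := (EReal.coe_toENNReal_eq_max.symm ▸ le_max_right _ _ :
    _ ≤ ((_ : EReal).toENNReal : EReal)).trans (EReal.coe_ennreal_le_coe_ennreal_iff.2 h.le)
  rw [EReal.div_le_iff_le_mul (by exact_mod_cast hL) (EReal.coe_ne_top _), mul_comm] at h2
  exact h2

/-- A finite infimum in `ℕ∞` is attained: a value below `N + 1` is at most `N`. -/
theorem exists_isCover_encard_le {s : Set X} {δ : ℝ≥0}
    (h : Metric.externalCoveringNumber δ s ≠ ⊤) :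
    ∃ C : Set X, Metric.IsCover δ s C ∧ C.encard ≤ Metric.externalCoveringNumber δ s := by
  have h1 : Metric.externalCoveringNumber δ s < Metric.externalCoveringNumber δ s + 1 :=
    (ENat.lt_add_one_iff h).2 le_rfl
  conv_lhs at h1 => unfold Metric.externalCoveringNumber
  simp only [iInf_lt_iff] at h1
  obtain ⟨C, hC, hlt⟩ := h1
  exact ⟨C, hC, (ENat.lt_add_one_iff h).1 hlt⟩

theorem upperBoxDim_finite {s : Set X} (hs : s.Finite) : upperBoxDim s = 0 := by
  obtain ⟨m, hm⟩ : ∃ m : ℕ, s.encard = m := ⟨_, hs.encard_eq_coe⟩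
  -- The bound `m + 1` instead of `m` lets `boxRatio_le` apply to the empty set too.
  have hev : ∀ᶠ δ : ℝ≥0 in 𝓝[>] 0, boxRatio s δ ≤
      ENNReal.ofReal (Real.log ((m + 1 : ℕ) : ℝ) / Real.log (1 / (δ : ℝ))) := by
    filter_upwards [Ioo_mem_nhdsGT (zero_lt_one' ℝ≥0)] with δ hδ
    refine boxRatio_le hδ.1 hδ.2 (by omega)
      ((Metric.externalCoveringNumber_le_encard_self s).trans ?_)
    rw [hm]; exact_mod_cast Nat.le_succ m
  have ht : Tendsto (fun δ : ℝ≥0 =>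
      ENNReal.ofReal (Real.log ((m + 1 : ℕ) : ℝ) / Real.log (1 / (δ : ℝ)))) (𝓝[>] 0) (𝓝 0) := by
    have h3 := ENNReal.tendsto_ofReal (tendsto_log_one_div_nhdsGT.const_div_atTop (Real.log ((m + 1 : ℕ) : ℝ)))
    simpa using h3
  exact le_antisymm ((limsup_le_limsup hev).trans ht.limsup_eq.le) bot_le

theorem lowerBoxDim_le_upperBoxDim (s : Set X) : lowerBoxDim s ≤ upperBoxDim s :=
  liminf_le_limsup

theorem packingDim_le_upperBoxDim (s : Set X) : packingDim s ≤ upperBoxDim s :=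
  iInf₂_le_of_le (fun _ => s) (subset_iUnion (fun _ : ℕ => s) 0) (iSup_le fun _ => le_rfl)

end Box

/-! ### Hausdorff dimension against box and packing dimension -/

section Hausdorff

variable {X : Type*} [EMetricSpace X]

/-- If the lower box dimension is below `e < d`, there are radii `δ k → 0` at which at most `δ k ^
(-e)` balls cover `s`. Their diameters to the power `d` add up to at most `2 ^ d * δ k ^ (d - e)`,
which tends to zero, so the `d`-dimensional measure cannot be infinite. -/
theorem dimH_le_lowerBoxDim (s : Set X) : dimH s ≤ lowerBoxDim s := by
  borelize X
  refine dimH_le fun d hd => le_of_not_gt fun hlt => ?_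
  obtain ⟨e, he1, he2⟩ := ENNReal.lt_iff_exists_nnreal_btwn.1 hlt
  have hed : (e : ℝ) < d := by exact_mod_cast he2
  have hfr : ∃ᶠ δ : ℝ≥0 in 𝓝[>] 0, boxRatio s δ < e ∧ δ ∈ Ioo (0 : ℝ≥0) 1 :=
    (frequently_lt_of_liminf_lt (by isBoundedDefault) he1).and_eventually
      (Ioo_mem_nhdsGT zero_lt_one)
  obtain ⟨δ, hδ, hprop⟩ := exists_seq_forall_of_frequently hfr
  have hN : ∀ k, (Metric.externalCoveringNumber (δ k) s : ℝ≥0∞) ≤ ((δ k : ℝ≥0∞)⁻¹) ^ (e : ℝ) :=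
    fun k => externalCoveringNumber_le_of_boxRatio_lt (hprop k).2.1 (hprop k).2.2 (hprop k).1
  have hδ0 : ∀ k, (δ k : ℝ≥0∞) ≠ 0 := fun k => by
    have := (hprop k).2.1
    exact_mod_cast this.ne'
  have htop : ∀ k, Metric.externalCoveringNumber (δ k) s ≠ ⊤ := fun k h => by
    have := hN k
    rw [h] at this
    have h2 : ((δ k : ℝ≥0∞)⁻¹) ^ (e : ℝ) ≠ ⊤ :=
      ENNReal.rpow_ne_top_of_nonneg e.2 (ENNReal.inv_ne_top.2 (hδ0 k))
    exact h2 (top_le_iff.1 this)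
  choose C hC hcard using fun k => exists_isCover_encard_le (htop k)
  have hfin : ∀ k, (C k).Finite := fun k => by
    refine Set.finite_of_encard_le_coe (k := (Metric.externalCoveringNumber (δ k) s).toNat) ?_
    rw [ENat.natCast_toNat (htop k)]; exact hcard k
  let ι : ℕ → Type _ := fun k => C k
  have : ∀ k, Fintype (ι k) := fun k => (hfin k).fintype
  have hδt : Tendsto (fun k => (δ k : ℝ≥0∞)) atTop (𝓝 0) := by
    exact ENNReal.tendsto_coe.2 (hδ.mono_right nhdsWithin_le_nhds)
  have hdiam : ∀ k (c : X), Metric.ediam (Metric.closedEBall c (δ k)) ≤ 2 * δ k := fun k c =>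
    Metric.ediam_closedEBall_le
  have key := Measure.hausdorffMeasure_le_liminf_sum (ι := ι) (d : ℝ) s (l := atTop)
    (fun k => 2 * (δ k : ℝ≥0∞)) (by simpa using ENNReal.Tendsto.const_mul hδt (Or.inr (by simp)))
    (fun k c => Metric.closedEBall (c : X) (δ k))
    (Eventually.of_forall fun k c => hdiam k c)
    (Eventually.of_forall fun k x hx => by
      obtain ⟨c, hc, hxc⟩ := hC k hx
      exact mem_iUnion.2 ⟨⟨c, hc⟩, hxc⟩)
  have hb : ∀ k, ∑ c : ι k, Metric.ediam (Metric.closedEBall (c : X) (δ k)) ^ (d : ℝ)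
      ≤ 2 ^ (d : ℝ) * (δ k : ℝ≥0∞) ^ ((d : ℝ) - e) := fun k => by
    calc ∑ c : ι k, Metric.ediam (Metric.closedEBall (c : X) (δ k)) ^ (d : ℝ)
        ≤ ∑ _c : ι k, (2 * (δ k : ℝ≥0∞)) ^ (d : ℝ) :=
          Finset.sum_le_sum fun c _ => ENNReal.rpow_le_rpow (hdiam k c) d.2
      _ = (Fintype.card (ι k) : ℝ≥0∞) * (2 * (δ k : ℝ≥0∞)) ^ (d : ℝ) := by
          simp [Finset.card_univ]
      _ ≤ ((δ k : ℝ≥0∞)⁻¹) ^ (e : ℝ) * (2 * (δ k : ℝ≥0∞)) ^ (d : ℝ) := by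
          gcongr
          refine le_trans ?_ (hN k)
          have h1 : ((Fintype.card (ι k) : ℕ) : ℕ∞) = (C k).encard := by
            rw [← Set.coe_fintypeCard]
          have h2 := ENat.toENNReal_le.2 (h1.trans_le (hcard k))
          simpa using h2
      _ = 2 ^ (d : ℝ) * (δ k : ℝ≥0∞) ^ ((d : ℝ) - e) := by
          rw [ENNReal.mul_rpow_of_nonneg _ _ d.coe_nonneg, ENNReal.inv_rpow, ← ENNReal.rpow_neg,
            sub_eq_add_neg, ENNReal.rpow_add _ _ (hδ0 k) ENNReal.coe_ne_top]
          ring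
  have hlim : Tendsto (fun k => 2 ^ (d : ℝ) * (δ k : ℝ≥0∞) ^ ((d : ℝ) - e)) atTop (𝓝 0) := by
    have h1 : Tendsto (fun k => (δ k : ℝ≥0∞) ^ ((d : ℝ) - e)) atTop (𝓝 0) := by
      have := ((ENNReal.continuous_rpow_const (y := (d : ℝ) - e)).tendsto 0).comp hδt
      rw [ENNReal.zero_rpow_of_pos (sub_pos.2 hed)] at this
      exact this
    simpa using ENNReal.Tendsto.const_mul h1
      (Or.inr (ENNReal.rpow_ne_top_of_nonneg d.2 (by simp)))
  have h0 := key.trans ((liminf_le_liminf (Eventually.of_forall hb)).trans hlim.liminf_eq.le)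
  rw [hd] at h0
  simp at h0

theorem dimH_le_packingDim (s : Set X) : dimH s ≤ packingDim s := by
  refine le_iInf₂ fun F hF => (dimH_mono hF).trans ?_
  rw [dimH_iUnion]
  exact iSup_mono fun i => (dimH_le_lowerBoxDim _).trans (lowerBoxDim_le_upperBoxDim _)

/-- A set whose upper box dimension is at most its Hausdorff dimension has all dimensions equal. -/
theorem dims_eq_of_upperBoxDim_le {s : Set X} (h : upperBoxDim s ≤ dimH s) :
    dimH s = packingDim s ∧ lowerBoxDim s = dimH s ∧ upperBoxDim s = dimH s :=
  ⟨le_antisymm (dimH_le_packingDim s) ((packingDim_le_upperBoxDim s).trans h),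
    le_antisymm ((lowerBoxDim_le_upperBoxDim s).trans h) (dimH_le_lowerBoxDim s),
    le_antisymm h ((dimH_le_lowerBoxDim s).trans (lowerBoxDim_le_upperBoxDim s))⟩

end Hausdorff

end FractalDim

namespace CantorSeries

/-! ### Cantor series -/

theorem hasSum_sub_one {q : ℕ → ℕ} (hq : IsBasic q) :
    HasSum (fun n => ((q n : ℝ) - 1) / partialProd q (n + 1)) 1 := by
  have hpos : ∀ n, (0 : ℝ) < partialProd q n := fun n => by exact_mod_cast partialProd_pos hq n
  have hg0 : ∀ n, 0 ≤ ((q n : ℝ) - 1) / partialProd q (n + 1) := fun n => by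
    have : (2 : ℝ) ≤ q n := by exact_mod_cast hq n
    exact div_nonneg (by linarith) (hpos _).le
  rw [hasSum_iff_tendsto_nat_of_nonneg hg0]
  have hgp : ∀ n, ∑ j ∈ Finset.range n, ((q j : ℝ) - 1) / partialProd q (j + 1)
      = 1 - 1 / partialProd q n := fun n => by
    induction n with
    | zero => simp [partialProd]
    | succ n ih =>
      have h1 := (hpos n).ne'
      have h2 : (q n : ℝ) ≠ 0 := by have := hq n; positivity
      rw [Finset.sum_range_succ, ih, partialProd_succ]
      push_cast; field_simp; ring
  simp only [hgp]
  simpa using (tendsto_inv_partialProd hq).const_sub 1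

theorem term_le_sub_one {q e : ℕ → ℕ} (he : ∀ n, e n < q n) (n : ℕ) :
    (e n : ℝ) / partialProd q (n + 1) ≤ ((q n : ℝ) - 1) / partialProd q (n + 1) := by
  refine div_le_div_of_nonneg_right ?_ (by positivity)
  have : (e n : ℝ) + 1 ≤ q n := by exact_mod_cast he n
  linarith

theorem summable_digits {q e : ℕ → ℕ} (hq : IsBasic q) (he : ∀ n, e n < q n) :
    Summable (fun n => (e n : ℝ) / partialProd q (n + 1)) :=
  Summable.of_nonneg_of_le (fun n => by positivity) (term_le_sub_one he) (hasSum_sub_one hq).summable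

theorem hasSum_lt_one {q e : ℕ → ℕ} {w : ℝ} (hq : IsBasic q) (he : ∀ n, e n < q n)
    {m : ℕ} (hm : e m ≠ q m - 1) (hs : HasSum (fun n => (e n : ℝ) / partialProd q (n + 1)) w) :
    w < 1 := by
  refine hasSum_lt (i := m) (term_le_sub_one he) ?_ hs (hasSum_sub_one hq)
  have hpos : (0 : ℝ) < partialProd q (m + 1) := by exact_mod_cast partialProd_pos hq _
  refine div_lt_div_of_pos_right ?_ hpos
  have h1 := he m
  have : (e m : ℝ) + 1 < q m := by exact_mod_cast (by omega : e m + 1 < q m)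
  linarith

theorem floor_eq_zero_of_mem {x : ℝ} (hx : x ∈ Ico (0 : ℝ) 1) : ⌊x⌋ = 0 :=
  Int.floor_eq_zero_iff.2 hx

theorem eq_digit_of_hasSum {q e : ℕ → ℕ} {w : ℝ} (hq : IsBasic q) (he : ∀ n, e n < q n)
    (hf : ∃ᶠ n in atTop, e n ≠ q n - 1)
    (hs : HasSum (fun n => (e n : ℝ) / partialProd q (n + 1)) w) :
    w ∈ Ico (0 : ℝ) 1 ∧ e = digit q w := by
  obtain ⟨m, hm⟩ := hf.exists
  have hw : w ∈ Ico (0 : ℝ) 1 := ⟨hs.nonneg fun n => by positivity, hasSum_lt_one hq he hm hs⟩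
  refine ⟨hw, (isExpansion_iff hq w e).1 ⟨he, hf, ?_⟩⟩
  rw [floor_eq_zero_of_mem hw]; simpa using hs

theorem hasSum_digit {q : ℕ → ℕ} (hq : IsBasic q) {x : ℝ} (hx : x ∈ Ico (0 : ℝ) 1) :
    HasSum (fun n => (digit q x n : ℝ) / partialProd q (n + 1)) x := by
  have h := (isExpansion_digit hq x).2.2
  rw [floor_eq_zero_of_mem hx] at h; simpa using h

theorem digit_lt {q : ℕ → ℕ} (hq : IsBasic q) (x : ℝ) (n : ℕ) : digit q x n < q n :=
  (isExpansion_digit hq x).1 n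

/-- The two expansions of a number with a terminating expansion. -/
theorem hasSum_carry_iff {q e e' : ℕ → ℕ} (hq : IsBasic q) {m : ℕ} (h1 : ∀ n < m, e' n = e n)
    (h2 : e' m = e m + 1) (h3 : ∀ n > m, e' n = 0 ∧ e n = q n - 1) {w : ℝ} :
    HasSum (fun n => (e n : ℝ) / partialProd q (n + 1)) w ↔
      HasSum (fun n => (e' n : ℝ) / partialProd q (n + 1)) w := by
  have hpos : ∀ n, (partialProd q n : ℝ) ≠ 0 := fun n => by
    exact_mod_cast (partialProd_pos hq n).ne'
  -- Past `m` the two partial sums differ by exactly one unit of the last place, which tends to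
  -- zero.
  have hd : ∀ n, m + 1 ≤ n → ∑ j ∈ Finset.range n, (e' j : ℝ) / partialProd q (j + 1)
      - ∑ j ∈ Finset.range n, (e j : ℝ) / partialProd q (j + 1) = 1 / partialProd q n := by
    intro n hn
    induction n, hn using Nat.le_induction with
    | base =>
      rw [Finset.sum_range_succ, Finset.sum_range_succ, h2,
        Finset.sum_congr rfl fun j hj => by rw [h1 j (Finset.mem_range.1 hj)]]
      push_cast; ring
    | succ n hn ih =>
      have h4 := h3 n (by omega)
      have hqn := hq n
      have h5 : (e n : ℝ) = q n - 1 := by rw [h4.2, Nat.cast_sub (by omega)]; simp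
      have h6 : (q n : ℝ) ≠ 0 := by positivity
      have h7 := hpos n
      have h8 : (1 : ℝ) / partialProd q n = 1 / partialProd q (n + 1)
          + ((q n : ℝ) - 1) / partialProd q (n + 1) := by
        rw [partialProd_succ]; push_cast; field_simp; ring
      rw [Finset.sum_range_succ, Finset.sum_range_succ, h4.1, h5]
      rw [h8] at ih
      push_cast
      rw [zero_div]
      linarith
  have hd0 : Tendsto (fun n => ∑ j ∈ Finset.range n, (e' j : ℝ) / partialProd q (j + 1)
      - ∑ j ∈ Finset.range n, (e j : ℝ) / partialProd q (j + 1)) atTop (𝓝 0) :=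
    (tendsto_inv_partialProd hq).congr' (by
      filter_upwards [eventually_ge_atTop (m + 1)] with n hn using (hd n hn).symm)
  rw [hasSum_iff_tendsto_nat_of_nonneg (fun n => by positivity),
    hasSum_iff_tendsto_nat_of_nonneg (fun n => by positivity)]
  constructor
  · intro h; simpa using h.add hd0
  · intro h; simpa using h.sub hd0

/-! ### The two expansions of `w` -/

section InfDigit

variable {q : ℕ → ℕ} {w : ℝ}

theorem infDigit_eq_digit (hw : w ∈ uniqueSet q) : infDigit q w = digit q w := by
  funext n
  obtain ⟨m, hm, h⟩ := (frequently_atTop.1 hw) (n + 1)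
  rw [infDigit, if_pos ⟨m, by omega, h⟩]

theorem isGreatest_iff {e : ℕ → ℕ} {M : ℕ} :
    IsGreatest {t | 0 < e t} M ↔ e M ≠ 0 ∧ ∀ n > M, e n = 0 := by
  constructor
  · exact fun h => ⟨h.1.ne', fun n hn => by
      by_contra h0
      exact absurd (h.2 (Nat.pos_of_ne_zero h0)) (by omega)⟩
  · exact fun h => ⟨Nat.pos_of_ne_zero h.1, fun n (hn : 0 < e n) => by
      by_contra h0
      exact hn.ne' (h.2 n (by omega))⟩

theorem infDigit_of_isGreatest {M : ℕ} (hM : IsGreatest {t | 0 < digit q w t} M) (n : ℕ) :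
    infDigit q w n = if n < M then digit q w n else if n = M then digit q w M - 1 else q n - 1 := by
  obtain ⟨h1, h2⟩ := isGreatest_iff.1 hM
  have hno : ∀ n, M ≤ n → ¬ ∃ m > n, digit q w m ≠ 0 := fun n hn ⟨m, hm, h⟩ => h (h2 m (by omega))
  rcases lt_trichotomy n M with h | h | h
  · rw [infDigit, if_pos ⟨M, h, h1⟩, if_pos h]
  · subst h
    rw [infDigit, if_neg (hno n le_rfl), if_pos h1]; simp
  · rw [infDigit, if_neg (hno n h.le), if_neg (by simpa using h2 n h), if_neg (by omega),
      if_neg (by omega)]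

theorem exists_isGreatest (hq : IsBasic q) (hw : w ∈ Ioo (0 : ℝ) 1) (hU : w ∉ uniqueSet q) :
    ∃ M, IsGreatest {t | 0 < digit q w t} M := by
  have hne : ∃ n, digit q w n ≠ 0 := by
    by_contra! h
    have hs := hasSum_digit hq ⟨hw.1.le, hw.2⟩
    simp only [h] at hs
    have := hs.tsum_eq
    simp only [Nat.cast_zero, zero_div, tsum_zero] at this
    exact hw.1.ne this
  obtain ⟨n0, hn0⟩ := hne
  have hU' : ∀ᶠ n in atTop, digit q w n = 0 := by
    simpa [uniqueSet] using hU
  obtain ⟨N, hN⟩ := eventually_atTop.1 hU'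
  have hbdd : BddAbove {t | 0 < digit q w t} := ⟨N, fun t (ht : 0 < digit q w t) => by
    by_contra h
    exact ht.ne' (hN t (by omega))⟩
  exact ⟨_, Nat.sSup_mem ⟨n0, Nat.pos_of_ne_zero hn0⟩ hbdd, fun t ht => le_csSup hbdd ht⟩

theorem infDigit_lt (hq : IsBasic q) (n : ℕ) : infDigit q w n < q n := by
  have h1 := digit_lt hq w n
  have h2 := hq n
  unfold infDigit
  split_ifs <;> omega

theorem hasSum_infDigit (hq : IsBasic q) (hw : w ∈ Ioo (0 : ℝ) 1) :
    HasSum (fun n => (infDigit q w n : ℝ) / partialProd q (n + 1)) w := by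
  have hs := hasSum_digit hq ⟨hw.1.le, hw.2⟩
  by_cases hU : w ∈ uniqueSet q
  · rwa [infDigit_eq_digit hU]
  · obtain ⟨M, hM⟩ := exists_isGreatest hq hw hU
    obtain ⟨h1, h2⟩ := isGreatest_iff.1 hM
    refine (hasSum_carry_iff hq (m := M) (fun n hn => ?_) ?_ fun n hn => ⟨h2 n hn, ?_⟩).2 hs
    · rw [infDigit_of_isGreatest hM, if_pos hn]
    · rw [infDigit_of_isGreatest hM]; simp; omega
    · rw [infDigit_of_isGreatest hM, if_neg (by omega), if_neg (by omega)]

theorem exists_infDigit_ne_zero (hq : IsBasic q) (hw : w ∈ Ioo (0 : ℝ) 1) :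
    ∃ n, infDigit q w n ≠ 0 := by
  by_contra! h
  have hs := hasSum_infDigit hq hw
  simp only [h] at hs
  have := hs.tsum_eq
  simp only [Nat.cast_zero, zero_div, tsum_zero] at this
  exact hw.1.ne this

/-- A sequence that does not end in maximal digits is the Cantor expansion. Otherwise let `m` be the
last index with a non-maximal digit; it exists because `w < 1`. Carrying into `m` gives a
terminating expansion, which must be `digit q w` with last nonzero digit at `m`, and undoing the
carry gives `infDigit q w`. -/
theorem eq_digit_or_eq_infDigit (hq : IsBasic q) (hw : w ∈ Ioo (0 : ℝ) 1) {e : ℕ → ℕ}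
    (he : ∀ n, e n < q n) (hs : HasSum (fun n => (e n : ℝ) / partialProd q (n + 1)) w) :
    e = digit q w ∨ e = infDigit q w := by
  by_cases hf : ∃ᶠ n in atTop, e n ≠ q n - 1
  · exact Or.inl (eq_digit_of_hasSum hq he hf hs).2
  right
  simp only [not_frequently, not_not] at hf
  obtain ⟨N, hN⟩ := eventually_atTop.1 hf
  have hne : ∃ n, e n ≠ q n - 1 := by
    by_contra! h
    have h1 : ∀ n, (e n : ℝ) = q n - 1 := fun n => by
      have := hq n
      rw [h n, Nat.cast_sub (by omega)]; simp
    simp only [h1] at hs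
    exact hw.2.ne (hs.unique (hasSum_sub_one hq))
  obtain ⟨n0, hn0⟩ := hne
  have hbdd : BddAbove {n | e n ≠ q n - 1} := ⟨N, fun t (ht : _ ≠ _) => by
    by_contra h
    exact ht (hN t (by omega))⟩
  set m := sSup {n | e n ≠ q n - 1} with hm
  have hmem : e m ≠ q m - 1 := Nat.sSup_mem (s := {n | e n ≠ q n - 1}) ⟨n0, hn0⟩ hbdd
  have hgt : ∀ n > m, e n = q n - 1 := fun n hn => by
    by_contra h
    have : n ≤ m := le_csSup hbdd h
    omega
  set e' : ℕ → ℕ := fun n => if n < m then e n else if n = m then e m + 1 else 0 with he'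
  have hs' : HasSum (fun n => (e' n : ℝ) / partialProd q (n + 1)) w :=
    (hasSum_carry_iff hq (m := m) (fun n hn => by simp [he', hn]) (by simp [he'])
      fun n hn => ⟨by simp [he', show ¬ n < m by omega, show n ≠ m by omega], hgt n hn⟩).1 hs
  have hd : e' = digit q w := by
    refine (eq_digit_of_hasSum hq (fun n => ?_) ?_ hs').2
    · have := he n
      have := he m
      have := hq n
      simp only [he']
      split_ifs with h1 h2
      · omega
      · subst h2; omega
      · omega
    · refine (eventually_gt_atTop m).frequently.mono fun n hn => ?_
      have := hq n
      simp only [he', if_neg (show ¬ n < m by omega), if_neg (show n ≠ m by omega)]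
      omega
  have hM : IsGreatest {t | 0 < digit q w t} m := by
    rw [isGreatest_iff, ← hd]
    exact ⟨by simp [he'], fun n hn => by simp [he', show ¬ n < m by omega, show n ≠ m by omega]⟩
  funext n
  rw [infDigit_of_isGreatest hM, ← hd]
  rcases lt_trichotomy n m with h | h | h
  · simp [he', h]
  · subst h; simp [he']
  · simp [show ¬ n < m by omega, show n ≠ m by omega, hgt n h]

end InfDigit

/-! ### Level sets as digit boxes -/

/-- The numbers in `(0,1)` whose truncated `p`-digits are the terms of `D`. -/
def branch (p q D : ℕ → ℕ) : Set ℝ :=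
  {x | x ∈ Ioo (0 : ℝ) 1 ∧ ∀ n, min (digit p x n) (q n - 1) = D n}

theorem levelSet_eq_union {p q : ℕ → ℕ} (hq : IsBasic q) {w : ℝ}
    (hw : w ∈ Ioo (0 : ℝ) 1) :
    levelSet p q w = branch p q (digit q w) ∪ branch p q (infDigit q w) := by
  have hlt : ∀ x n, min (digit p x n) (q n - 1) < q n := fun x n => by
    have := hq n
    omega
  have hdw := hasSum_digit hq ⟨hw.1.le, hw.2⟩
  ext x
  constructor
  · rintro ⟨hx, hpsi⟩
    have hs := (summable_digits hq (hlt x)).hasSum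
    rw [show ∑' n, ((min (digit p x n) (q n - 1) : ℕ) : ℝ) / partialProd q (n + 1) = w from hpsi]
      at hs
    rcases eq_digit_or_eq_infDigit hq hw (hlt x) hs with h | h
    · exact Or.inl ⟨hx, fun n => congrFun h n⟩
    · exact Or.inr ⟨hx, fun n => congrFun h n⟩
  · rintro (⟨hx, h⟩ | ⟨hx, h⟩) <;> refine ⟨hx, ?_⟩ <;> unfold psi <;> simp only [h]
    · exact hdw.tsum_eq
    · exact (hasSum_infDigit hq hw).tsum_eq

/-- The numbers in `[0,1)` whose `n`-th `p`-digit lies in `[l n, l n + a n)` for all `n`. -/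
def digitBox (p l a : ℕ → ℕ) : Set ℝ :=
  {x | x ∈ Ico (0 : ℝ) 1 ∧ ∀ n, digit p x n ∈ Ico (l n) (l n + a n)}

/-- The number of digits below `p n` whose truncation at `q n - 1` is `D n`. -/
def digitCount (p q D : ℕ → ℕ) (n : ℕ) : ℕ :=
  if p n ≤ D n then 0 else if D n ≤ q n - 2 then 1 else p n - q n + 1

theorem omega_eq_digitCount (p q : ℕ → ℕ) (w : ℝ) :
    omega p q w = digitCount p q (digit q w) := rfl

/-- Only the value `q n - 1` has several preimages under truncation, namely `q n - 1, …, p n - 1`.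
The first case of `digitCount` removes `p n ≤ D n`, so the natural subtraction `p n - q n` is exact
whenever it is used. -/
theorem min_eq_iff_mem {p q D : ℕ → ℕ} (hq : IsBasic q) (hD : ∀ n, D n < q n)
    {d n : ℕ} (hd : d < p n) :
    min d (q n - 1) = D n ↔ d ∈ Ico (D n) (D n + digitCount p q D n) := by
  have h1 := hq n
  have h3 := hD n
  unfold digitCount
  rw [mem_Ico]
  split_ifs <;> omega

theorem branch_eq_digitBox {p q D : ℕ → ℕ} (hp : IsBasic p) (hq : IsBasic q)
    (hD : ∀ n, D n < q n) (h0 : ∃ n, D n ≠ 0) :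
    branch p q D = digitBox p D (digitCount p q D) := by
  ext x
  simp only [branch, digitBox, mem_ofPred_eq]
  have h : (∀ n, min (digit p x n) (q n - 1) = D n) ↔
      ∀ n, digit p x n ∈ Ico (D n) (D n + digitCount p q D n) :=
    forall_congr' fun n => min_eq_iff_mem hq hD (digit_lt hp x n)
  rw [h]
  refine and_congr_left fun hx => ⟨fun h => ⟨h.1.le, h.2⟩, fun h1 => ⟨?_, h1.2⟩⟩
  -- A digit box may contain `0`, all of whose digits vanish; a nonzero term of `D` excludes it.
  refine lt_of_le_of_ne h1.1 fun h2 => ?_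
  obtain ⟨n, hn⟩ := h0
  have := (hx n).1
  rw [← h2] at this
  simp [digit] at this
  exact hn this

theorem add_digitCount_le {p q D : ℕ → ℕ} (hq : IsBasic q) (hD : ∀ n, D n < q n) {n : ℕ}
    (h : digitCount p q D n ≠ 0) : D n + digitCount p q D n ≤ p n := by
  have h1 := hq n
  have h3 := hD n
  unfold digitCount at h ⊢
  split_ifs at h ⊢ <;> omega

/-- As `q n - 1 ≥ 1`, a truncated digit is zero only if the digit itself is. Hence the first `M + 1`
digits determine `x`. -/
theorem finite_branch_of_eventually_zero {p q D : ℕ → ℕ} (hp : IsBasic p) (hq : IsBasic q)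
    {M : ℕ} (hM : ∀ n > M, D n = 0) : (branch p q D).Finite := by
  refine ((Fintype.piFinset fun i : Fin (M + 1) => Finset.range (p i)).finite_toSet.image
    fun F : Fin (M + 1) → ℕ => ∑ i, (F i : ℝ) / partialProd p (i + 1)).subset ?_
  rintro x ⟨hx, h⟩
  refine ⟨fun i => digit p x i, ?_, ?_⟩
  · simpa using fun i => digit_lt hp x _
  · have hs := hasSum_digit hp ⟨hx.1.le, hx.2⟩
    have h0 : ∀ n ∉ Finset.range (M + 1), (digit p x n : ℝ) / partialProd p (n + 1) = 0 := by
      intro n hn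
      have h1 := h n
      rw [hM n (by simpa using hn)] at h1
      have h2 := hq n
      have : digit p x n = 0 := by omega
      simp [this]
    refine Eq.trans ?_ ((hasSum_sum_of_ne_finset_zero h0).unique hs)
    exact Fin.sum_univ_eq_sum_range (fun i => (digit p x i : ℝ) / partialProd p (i + 1)) (M + 1)

/-- The level set is a digit box up to a finite set, which is empty for points with a unique
expansion. -/
theorem exists_levelSet_eq {p q : ℕ → ℕ} (hp : IsBasic p) (hq : IsBasic q) {w : ℝ}
    (hw : w ∈ Ioo (0 : ℝ) 1) :
    ∃ F : Set ℝ, F.Finite ∧ levelSet p q w =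
      digitBox p (infDigit q w) (digitCount p q (infDigit q w)) ∪ F := by
  have h1 := branch_eq_digitBox hp hq (infDigit_lt hq (w := w)) (exists_infDigit_ne_zero hq hw)
  have h2 := levelSet_eq_union (p := p) hq hw
  rw [h1] at h2
  by_cases hU : w ∈ uniqueSet q
  · refine ⟨∅, finite_empty, ?_⟩
    rw [infDigit_eq_digit hU] at h1 h2 ⊢
    rw [h2, h1, union_self, union_empty]
  · obtain ⟨M, hM⟩ := exists_isGreatest hq hw hU
    exact ⟨_, finite_branch_of_eventually_zero hp hq (isGreatest_iff.1 hM).2,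
      h2.trans (union_comm _ _)⟩

/-- The hypothesis matters: when `p n ≤ infDigit q w n ≤ q n - 2`, `digitSet` is still a singleton
although no `p`-digit is admissible. -/
theorem card_digitSet {p q : ℕ → ℕ} {w : ℝ} (hq : IsBasic q) {n : ℕ}
    (h : digitCount p q (infDigit q w) n ≠ 0) :
    (digitSet p q w n).card = digitCount p q (infDigit q w) n := by
  have h1 := hq n
  have h2 := infDigit_lt hq (w := w) n
  unfold digitSet
  unfold digitCount at h ⊢
  split_ifs at h ⊢ <;> first | exact absurd rfl h | simp <;> omega

theorem measurable_digit (p : ℕ → ℕ) (n : ℕ) : Measurable fun x => digit p x n := by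
  unfold digit
  exact (measurable_of_countable fun k : ℤ => (k % (p n : ℤ)).toNat).comp
    (Int.measurable_floor.comp (measurable_id.mul_const _))

theorem measurableSet_digitBox (p l a : ℕ → ℕ) : MeasurableSet (digitBox p l a) := by
  have h : digitBox p l a = Ico (0 : ℝ) 1 ∩
      ⋂ n, (fun x => digit p x n) ⁻¹' Ico (l n) (l n + a n) := by
    ext x; simp [digitBox]
  rw [h]
  exact measurableSet_Ico.inter
    (MeasurableSet.iInter fun n => measurable_digit p n MeasurableSet.of_discrete)

end CantorSeries

/-! ### Covering numbers of finite unions of intervals -/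

namespace FractalDim

theorem externalCoveringNumber_union_le {X : Type*} [PseudoEMetricSpace X] (δ : ℝ≥0) (s t : Set X) :
    Metric.externalCoveringNumber δ (s ∪ t) ≤ Metric.externalCoveringNumber δ s + t.encard := by
  by_cases h : Metric.externalCoveringNumber δ s = ⊤
  · simp [h]
  obtain ⟨C, hC, hle⟩ := exists_isCover_encard_le h
  have hu : Metric.IsCover δ (s ∪ t) (C ∪ t) := by
    rintro x (hx | hx)
    · obtain ⟨c, hc, hxc⟩ := hC hx
      exact ⟨c, Or.inl hc, hxc⟩
    · exact ⟨x, Or.inr hx, by simp⟩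
  exact hu.externalCoveringNumber_le_encard.trans
    ((encard_union_le C t).trans (add_le_add hle le_rfl))

/-- Each interval is cut into `⌈r / δ⌉₊` pieces of length `δ`, and balls are centred at the left
ends of the pieces. -/
theorem externalCoveringNumber_le_card_mul {ι : Type*} {s : Set ℝ} (T : Finset ι) (c : ι → ℝ)
    {r : ℝ} (hs : ∀ x ∈ s, ∃ k ∈ T, x ∈ Icc (c k) (c k + r)) {δ : ℝ≥0} (hδ : 0 < δ)
    (hr : 0 < r) :
    Metric.externalCoveringNumber δ s ≤ (T.card * ⌈r / δ⌉₊ : ℕ) := by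
  classical
  have hδ' : (0 : ℝ) < δ := hδ
  set C : Finset ℝ := (T ×ˢ Finset.range ⌈r / δ⌉₊).image fun k => c k.1 + k.2 * δ with hC
  have hcov : Metric.IsCover δ s (C : Set ℝ) := by
    intro x hx
    obtain ⟨k, hk, h1, h2⟩ := hs x hx
    -- The piece containing `x` has index `m - 1`; truncated subtraction gives index `0` when `x = c
    -- k`.
    set m := ⌈(x - c k) / δ⌉₊ with hm
    have hm1 : m ≤ ⌈r / δ⌉₊ :=
      Nat.ceil_le_ceil (div_le_div_of_nonneg_right (by linarith) hδ'.le)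
    have hm0 : 0 < ⌈r / δ⌉₊ := Nat.ceil_pos.2 (by positivity)
    have hm2 : x - c k ≤ m * δ := (div_le_iff₀ hδ').1 (Nat.le_ceil _)
    have hm3 : ((m - 1 : ℕ) : ℝ) * δ ≤ x - c k := by
      rcases Nat.eq_zero_or_pos m with h0 | h0
      · rw [h0]; simp; linarith
      · have : ((m - 1 : ℕ) : ℝ) < (x - c k) / δ := Nat.lt_ceil.1 (by omega)
        exact ((lt_div_iff₀ hδ').1 this).le
    have hm4 : x - c k ≤ ((m - 1 : ℕ) : ℝ) * δ + δ := by
      have : (m : ℝ) ≤ ((m - 1 : ℕ) : ℝ) + 1 := by exact_mod_cast (by omega : m ≤ m - 1 + 1)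
      nlinarith
    refine ⟨c k + ((m - 1 : ℕ) : ℝ) * δ, ?_, ?_⟩
    · rw [hC, Finset.coe_image]
      exact ⟨(k, m - 1), by simp [hk]; omega, rfl⟩
    · change edist x _ ≤ δ
      rw [edist_nndist, ENNReal.coe_le_coe, ← NNReal.coe_le_coe, coe_nndist, Real.dist_eq, abs_le]
      constructor <;> linarith
  refine hcov.externalCoveringNumber_le_encard.trans ?_
  rw [Set.encard_coe_eq_coe_finsetCard]
  refine Nat.cast_le.2 (Finset.card_image_le.trans ?_)
  rw [Finset.card_product, Finset.card_range]

end FractalDim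

namespace CantorSeries

/-! ### Prefixes, measure and coverings of a digit box -/

section Box

variable {p l a : ℕ → ℕ}

/-- The integers `⌊x p_1 ⋯ p_n⌋` for the numbers `x` in `[0,1)` whose first `n` digits lie in
`[l j, l j + a j)`. -/
noncomputable def prefixes (p l a : ℕ → ℕ) : ℕ → Finset ℤ
  | 0 => {0}
  | n + 1 => (prefixes p l a n ×ˢ Finset.Ico (l n) (l n + a n)).image fun k => p n * k.1 + k.2

theorem mem_prefixes_succ {n : ℕ} {m : ℤ} : m ∈ prefixes p l a (n + 1) ↔
    ∃ k ∈ prefixes p l a n, ∃ d ∈ Ico (l n) (l n + a n), (p n : ℤ) * k + (d : ℤ) = m := by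
  simp only [prefixes, Finset.mem_image, Finset.mem_product, Prod.exists, Finset.mem_Ico, mem_Ico]
  constructor
  · rintro ⟨k, d, ⟨h1, h2⟩, h3⟩; exact ⟨k, h1, d, h2, h3⟩
  · rintro ⟨k, h1, d, h2, h3⟩; exact ⟨k, d, ⟨h1, h2⟩, h3⟩

theorem mul_add_inj {b k k' : ℤ} {d d' : ℕ} (hd : (d : ℤ) < b) (hd' : (d' : ℤ) < b)
    (h : b * k + d = b * k' + d') : k = k' ∧ d = d' := by
  have h1 : (b * k + d) / b = k := by
    rw [Int.add_comm, Int.add_mul_ediv_left _ _ (by omega), Int.ediv_eq_zero_of_lt (by omega) hd]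
    simp
  have h2 : (b * k' + d') / b = k' := by
    rw [Int.add_comm, Int.add_mul_ediv_left _ _ (by omega), Int.ediv_eq_zero_of_lt (by omega) hd']
    simp
  have h3 : k = k' := by rw [← h1, ← h2, h]
  subst h3
  exact ⟨rfl, by omega⟩

/-- The bound is asked only where `a n ≠ 0`, since an empty digit range may start beyond `p n`. -/
theorem lt_of_mem_Ico_digits {n d : ℕ} (hla : ∀ n, a n ≠ 0 → l n + a n ≤ p n)
    (hd : d ∈ Ico (l n) (l n + a n)) : (d : ℤ) < p n := by
  have h1 := hla n (by have := hd.1; have := hd.2; omega)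
  have := hd.2
  omega

theorem card_prefixes (hla : ∀ n, a n ≠ 0 → l n + a n ≤ p n) (n : ℕ) :
    (prefixes p l a n).card = partialProd a n := by
  induction n with
  | zero => simp [prefixes, partialProd]
  | succ n ih =>
    rw [prefixes, Finset.card_image_of_injOn, Finset.card_product, ih, partialProd_succ]
    · simp
    · rintro ⟨k, d⟩ h1 ⟨k', d'⟩ h2 h
      simp only [Finset.coe_product, mem_prod, Finset.mem_coe, Finset.mem_Ico] at h1 h2
      obtain ⟨h3, h4⟩ := mul_add_inj (lt_of_mem_Ico_digits hla h1.2)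
        (lt_of_mem_Ico_digits hla h2.2) h
      exact Prod.ext h3 h4

theorem floor_mem_prefixes_iff (hp : IsBasic p) (hla : ∀ n, a n ≠ 0 → l n + a n ≤ p n)
    (x : ℝ) (n : ℕ) : ⌊x * partialProd p n⌋ ∈ prefixes p l a n ↔
      x ∈ Ico (0 : ℝ) 1 ∧ ∀ j < n, digit p x j ∈ Ico (l j) (l j + a j) := by
  induction n with
  -- At level zero the condition `⌊x⌋ = 0` already encodes `x ∈ [0,1)`.
  | zero => simp [prefixes, partialProd, Int.floor_eq_zero_iff]
  | succ n ih =>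
    rw [mem_prefixes_succ]
    constructor
    · rintro ⟨k, hk, d, hd, h⟩
      rw [floor_succ hp] at h
      obtain ⟨h1, h2⟩ := mul_add_inj (lt_of_mem_Ico_digits hla hd)
        (by exact_mod_cast digit_lt hp x n) h
      rw [h1] at hk
      obtain ⟨h3, h4⟩ := ih.1 hk
      refine ⟨h3, fun j hj => ?_⟩
      rcases Nat.lt_succ_iff_lt_or_eq.1 hj with h5 | rfl
      · exact h4 j h5
      · rwa [← h2]
    · rintro ⟨h1, h2⟩
      exact ⟨_, ih.2 ⟨h1, fun j hj => h2 j (by omega)⟩, _, h2 n (by omega),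
        (floor_succ hp x n).symm⟩

theorem volume_floor_mem {P : ℕ} (hP : 0 < P) (T : Finset ℤ) :
    volume {x : ℝ | ⌊x * P⌋ ∈ T} = (T.card : ℝ≥0∞) / P := by
  have hP' : (0 : ℝ) < P := by exact_mod_cast hP
  have hk : ∀ k : ℤ, {x : ℝ | ⌊x * P⌋ = k} = Ico ((k : ℝ) / P) ((k + 1) / P) := fun k => by
    ext x
    rw [mem_ofPred_eq, Int.floor_eq_iff, mem_Ico, div_le_iff₀ hP', lt_div_iff₀ hP']
  have h1 : {x : ℝ | ⌊x * P⌋ ∈ T} = ⋃ k ∈ T, {x : ℝ | ⌊x * P⌋ = k} := by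
    ext x; simp
  rw [h1, measure_biUnion_finset]
  · have h2 : ∀ k : ℤ, volume {x : ℝ | ⌊x * P⌋ = k} = (P : ℝ≥0∞)⁻¹ := fun k => by
      rw [hk, Real.volume_Ico, ← sub_div, add_sub_cancel_left, one_div,
        ENNReal.ofReal_inv_of_pos hP', ENNReal.ofReal_natCast]
    simp only [h2, Finset.sum_const, nsmul_eq_mul, div_eq_mul_inv]
  · intro k _ k' _ hne
    refine Set.disjoint_left.2 fun x hx hx' => hne ?_
    exact (show ⌊x * P⌋ = k from hx).symm.trans hx'
  · intro k _
    rw [hk]; exact measurableSet_Ico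

theorem prod_div_eq (hp : IsBasic p) (n : ℕ) :
    ∏ j ∈ Finset.range n, (a j : ℝ≥0∞) / (p j : ℝ≥0∞) =
      (partialProd a n : ℝ≥0∞) / (partialProd p n : ℝ≥0∞) := by
  induction n with
  | zero => simp [partialProd]
  | succ n ih =>
    have h1 : (p n : ℝ≥0∞) ≠ 0 := by have := hp n; simp; omega
    have h2 : (partialProd p n : ℝ≥0∞) ≠ 0 := by have := partialProd_pos hp n; simp; omega
    rw [Finset.prod_range_succ, ih, partialProd_succ, partialProd_succ]
    push_cast
    simp only [div_eq_mul_inv]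
    rw [ENNReal.mul_inv (Or.inl h2) (Or.inr h1)]
    ring

/-- Continuity from above: prescribing the first `n` digit ranges leaves one interval of length `1 /
P n` for each prefix, and these sets decrease to the box. -/
theorem tendsto_prod_volume_digitBox (hp : IsBasic p) (hla : ∀ n, a n ≠ 0 → l n + a n ≤ p n) :
    Tendsto (fun n => ∏ j ∈ Finset.range n, (a j : ℝ≥0∞) / (p j : ℝ≥0∞)) atTop
      (𝓝 (volume (digitBox p l a))) := by
  set S : ℕ → Set ℝ := fun n => {x | ⌊x * partialProd p n⌋ ∈ prefixes p l a n} with hS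
  have hv : ∀ n, volume (S n) = ∏ j ∈ Finset.range n, (a j : ℝ≥0∞) / (p j : ℝ≥0∞) := fun n => by
    rw [prod_div_eq hp, hS, volume_floor_mem (partialProd_pos hp n), card_prefixes hla]
  have hi : digitBox p l a = ⋂ n, S n := by
    ext x
    simp only [hS, mem_iInter, mem_ofPred_eq, floor_mem_prefixes_iff hp hla, digitBox]
    exact ⟨fun h n => ⟨h.1, fun j _ => h.2 j⟩,
      fun h => ⟨(h 0).1, fun n => (h (n + 1)).2 n n.lt_succ_self⟩⟩
  have hanti : Antitone S := antitone_nat_of_succ_le fun n x hx => by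
    simp only [hS, mem_ofPred_eq, floor_mem_prefixes_iff hp hla] at hx ⊢
    exact ⟨hx.1, fun j hj => hx.2 j (by omega)⟩
  have hmeas : ∀ n, MeasurableSet (S n) := fun n =>
    (Int.measurable_floor.comp (measurable_id.mul_const _)) (MeasurableSet.of_discrete (s := (prefixes p l a n : Set ℤ)))
  simp only [← hv]
  rw [hi]
  refine tendsto_measure_iInter_atTop (fun n => (hmeas n).nullMeasurableSet) hanti ⟨0, ?_⟩
  rw [hv]; simp

/-- Since the next digit is also restricted, a prefix of length `n` confines `x` to length `a n / P
(n + 1)` rather than `1 / P n`. This produces the term `- log (a n)` in `lowerRatio`. -/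
theorem mem_Icc_of_mem_digitBox (hp : IsBasic p) {x : ℝ} (hx : x ∈ digitBox p l a) (n : ℕ) :
    x ∈ Icc (((p n * ⌊x * partialProd p n⌋ + l n : ℤ) : ℝ) / partialProd p (n + 1))
      (((p n * ⌊x * partialProd p n⌋ + l n : ℤ) : ℝ) / partialProd p (n + 1)
        + (a n : ℝ) / partialProd p (n + 1)) := by
  have hpos : (0 : ℝ) < partialProd p (n + 1) := by exact_mod_cast partialProd_pos hp _
  have h1 := Int.floor_le (x * partialProd p (n + 1))
  have h2 := Int.lt_floor_add_one (x * partialProd p (n + 1))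
  rw [floor_succ hp] at h1 h2
  obtain ⟨h3, h4⟩ := hx.2 n
  have h3' : (l n : ℝ) ≤ digit p x n := by exact_mod_cast h3
  have h4' : (digit p x n : ℝ) + 1 ≤ l n + a n := by exact_mod_cast h4
  push_cast at h1 h2 ⊢
  rw [mem_Icc, ← add_div, div_le_iff₀ hpos, le_div_iff₀ hpos]
  constructor <;> linarith

theorem externalCoveringNumber_digitBox_le (hp : IsBasic p)
    (hla : ∀ n, a n ≠ 0 → l n + a n ≤ p n) (n : ℕ) {δ : ℝ≥0} (hδ : 0 < δ) (ha : 0 < a n) :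
    Metric.externalCoveringNumber δ (digitBox p l a) ≤
      (partialProd a n * ⌈(a n : ℝ) / partialProd p (n + 1) / δ⌉₊ : ℕ) := by
  have hpos : (0 : ℝ) < partialProd p (n + 1) := by exact_mod_cast partialProd_pos hp _
  rw [← card_prefixes (p := p) (l := l) hla n]
  refine externalCoveringNumber_le_card_mul _
    (fun k : ℤ => ((p n * k + l n : ℤ) : ℝ) / partialProd p (n + 1)) (fun x hx => ?_) hδ
    (by positivity)
  exact ⟨_, (floor_mem_prefixes_iff hp hla x n).2 ⟨hx.1, fun j _ => hx.2 j⟩,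
    mem_Icc_of_mem_digitBox hp hx n⟩

theorem partialProd_mono_of_le {a p : ℕ → ℕ} (h : ∀ n, a n ≤ p n) (n : ℕ) :
    partialProd a n ≤ partialProd p n := Finset.prod_le_prod' fun j _ => h j

theorem partialProd_pos' {a : ℕ → ℕ} (h : ∀ n, 0 < a n) (n : ℕ) : 0 < partialProd a n :=
  Finset.prod_pos fun j _ => h j

theorem log_partialProd_succ {a : ℕ → ℕ} (h : ∀ n, 0 < a n) (n : ℕ) :
    Real.log (partialProd a (n + 1)) = Real.log (partialProd a n) + Real.log (a n) := by
  have h1 := partialProd_pos' h n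
  have h2 := h n
  rw [partialProd_succ]; push_cast
  rw [Real.log_mul (by positivity) (by positivity)]

theorem tendsto_log_partialProd (hp : IsBasic p) :
    Tendsto (fun n => Real.log (partialProd p n)) atTop atTop := by
  refine Real.tendsto_log_atTop.comp (tendsto_atTop_mono (fun n => ?_)
    (tendsto_pow_atTop_atTop_of_one_lt (one_lt_two (α := ℝ))))
  exact_mod_cast two_pow_le_partialProd hp n

/-- `log ∏_{j ≤ n} a_j / (log ∏_{j ≤ n+1} p_j - log a_{n+1})`. -/
noncomputable def lowerRatio (p a : ℕ → ℕ) (n : ℕ) : ℝ :=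
  Real.log (partialProd a n) / (Real.log (partialProd p (n + 1)) - Real.log (a n))

/-- `log ∏_{j ≤ n+1} a_j / (log ∏_{j ≤ n} p_j + log a_{n+1})`. -/
noncomputable def upperRatio (p a : ℕ → ℕ) (n : ℕ) : ℝ :=
  Real.log (partialProd a (n + 1)) / (Real.log (partialProd p n) + Real.log (a n))

/-- At radius `a n / P (n + 1)` one ball per prefix suffices, and a lower limit along these radii
dominates the lower box dimension. -/
theorem dimH_digitBox_le_liminf (hp : IsBasic p) (ha : ∀ n, 0 < a n)
    (hla : ∀ n, l n + a n ≤ p n) :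
    dimH (digitBox p l a) ≤ liminf (fun n => ENNReal.ofReal (lowerRatio p a n)) atTop := by
  have hpos : ∀ n, (0 : ℝ) < partialProd p n := fun n => by exact_mod_cast partialProd_pos hp _
  set δ : ℕ → ℝ≥0 := fun n => (a n : ℝ≥0) / partialProd p (n + 1) with hδ
  have hδc : ∀ n, (δ n : ℝ) = (a n : ℝ) / partialProd p (n + 1) := fun n => by simp [hδ]
  have hδ0 : ∀ n, 0 < δ n := fun n => by
    rw [← NNReal.coe_pos, hδc]
    have := ha n
    have := hpos (n + 1)
    positivity
  have hδle : ∀ n, (δ n : ℝ) ≤ 1 / partialProd p n := fun n => by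
    rw [hδc, div_le_div_iff₀ (hpos _) (hpos _), partialProd_succ]
    have h1 : (a n : ℝ) ≤ p n := by exact_mod_cast (by have := hla n; omega : a n ≤ p n)
    have := hpos n
    push_cast; nlinarith
  have hδt : Tendsto δ atTop (𝓝[>] 0) := by
    refine tendsto_nhdsWithin_of_tendsto_nhds_of_eventually_within _ ?_ (Eventually.of_forall hδ0)
    rw [← NNReal.tendsto_coe]
    exact squeeze_zero (fun n => (δ n).2) hδle (tendsto_inv_partialProd hp)
  refine (dimH_le_lowerBoxDim _).trans ((liminf_le_liminf_of_le hδt).trans ?_)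
  rw [← Filter.liminf_comp]
  refine liminf_le_liminf ?_
  filter_upwards [hδt.eventually (Ioo_mem_nhdsGT (zero_lt_one' ℝ≥0))] with n hn
  have h1 := boxRatio_le (m := partialProd a n) hn.1 hn.2 (partialProd_pos' ha n) (by
    have := externalCoveringNumber_digitBox_le hp (fun n _ => hla n) n (hδ0 n) (ha n)
    rwa [← hδc, div_self (by exact_mod_cast (hδ0 n).ne'), Nat.ceil_one, mul_one] at this)
  have h2 : Real.log (1 / (δ n : ℝ)) = Real.log (partialProd p (n + 1)) - Real.log (a n) := by
    have := ha n
    rw [hδc, one_div, inv_div, Real.log_div (hpos _).ne' (by positivity)]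
  rw [h2] at h1
  exact h1

end Box

end CantorSeries

namespace CantorSeries

/-! ### Lower bound for the Hausdorff dimension by lifting the unit interval -/

section Lift

variable {p l a : ℕ → ℕ}

/-- The counts `a n` may equal `1`, so `a` need not be basic; the digit facts for the base `a`
therefore assume positivity only. -/
theorem digit_lt_of_pos (ha : ∀ n, 0 < a n) (t : ℝ) (n : ℕ) : digit a t n < a n := by
  have h2 := ha n
  have h := Int.emod_lt_of_pos ⌊t * partialProd a (n + 1)⌋ (b := (a n : ℤ)) (by omega)
  unfold digit
  omega

theorem floor_succ_of_pos (ha : ∀ n, 0 < a n) (t : ℝ) (n : ℕ) :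
    ⌊t * partialProd a (n + 1)⌋ = a n * ⌊t * partialProd a n⌋ + (digit a t n : ℤ) := by
  have h2 := ha n
  have hq0 : (a n : ℤ) ≠ 0 := by omega
  have hqr : (a n : ℝ) ≠ 0 := by exact_mod_cast hq0
  have hdiv : ⌊t * partialProd a n⌋ = ⌊t * partialProd a (n + 1)⌋ / (a n : ℤ) := by
    rw [← Int.floor_div_natCast]
    congr 1
    rw [partialProd_succ]; push_cast; field_simp
  have hd : (digit a t n : ℤ) = ⌊t * partialProd a (n + 1)⌋ % (a n : ℤ) :=
    Int.toNat_of_nonneg (Int.emod_nonneg _ hq0)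
  rw [hd, hdiv]
  exact (Int.mul_ediv_add_emod _ _).symm

/-- The gap from `t * A n` up to the next integer is multiplied by `a n` at every maximal digit.
With only maximal digits it would grow like `A n`, yet it is at most `1`. -/
theorem frequently_digit_ne (ha : ∀ n, 0 < a n)
    (hN : Tendsto (fun n => (partialProd a n : ℝ)) atTop atTop) (t : ℝ) :
    ∃ᶠ n in atTop, digit a t n ≠ a n - 1 := by
  intro hev
  simp only [not_not] at hev
  obtain ⟨N, hN'⟩ := eventually_atTop.1 hev
  set r : ℕ → ℝ := fun n => ⌊t * partialProd a n⌋ + 1 - t * partialProd a n with hr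
  have hr0 : 0 < r N := by
    have := Int.lt_floor_add_one (t * partialProd a N); simp only [hr]; linarith
  have hr1 : ∀ n, r n ≤ 1 := fun n => by
    have := Int.floor_le (t * partialProd a n); simp only [hr]; linarith
  have hA : (0 : ℝ) < partialProd a N := by exact_mod_cast partialProd_pos' ha N
  have hmul : ∀ n, N ≤ n → r n * partialProd a N = r N * partialProd a n := fun n hn => by
    induction n, hn using Nat.le_induction with
    | base => rfl
    | succ n hn ih =>
      have h1 : (⌊t * partialProd a (n + 1)⌋ : ℝ)
          = a n * ⌊t * partialProd a n⌋ + (digit a t n : ℝ) := by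
        exact_mod_cast floor_succ_of_pos ha t n
      have hd : (digit a t n : ℝ) = a n - 1 := by
        rw [hN' n hn, Nat.cast_sub (ha n)]; simp
      have : r (n + 1) = a n * r n := by
        simp only [hr]
        rw [h1, hd, partialProd_succ]; push_cast; ring
      rw [this, partialProd_succ, mul_assoc, ih]; push_cast; ring
  obtain ⟨n, hn1, hn2⟩ := ((hN.eventually_gt_atTop (partialProd a N / r N)).and
    (eventually_ge_atTop N)).exists
  rw [div_lt_iff₀ hr0] at hn1
  have := hmul n hn2
  nlinarith [hr1 n]

/-- The number whose `p`-digits are the `a`-digits of `t`, shifted by `l`. -/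
noncomputable def lift (p l a : ℕ → ℕ) (t : ℝ) : ℝ :=
  ∑' n, ((l n + digit a t n : ℕ) : ℝ) / partialProd p (n + 1)

/-- A non-maximal `a`-digit stays non-maximal after the shift because `l n + a n ≤ p n`. So the
shifted sequence is a genuine Cantor expansion. -/
theorem lift_spec (hp : IsBasic p) (ha : ∀ n, 0 < a n) (hla : ∀ n, l n + a n ≤ p n)
    (hN : Tendsto (fun n => (partialProd a n : ℝ)) atTop atTop) (t : ℝ) :
    lift p l a t ∈ Ico (0 : ℝ) 1 ∧ (fun n => l n + digit a t n) = digit p (lift p l a t) := by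
  have hlt : ∀ n, l n + digit a t n < p n := fun n => by
    have := digit_lt_of_pos ha t n
    have := hla n
    omega
  refine eq_digit_of_hasSum hp hlt ((frequently_digit_ne ha hN t).mono fun n hn => ?_)
    (summable_digits hp hlt).hasSum
  have := digit_lt_of_pos ha t n
  have := hla n
  omega

theorem lift_mem_digitBox (hp : IsBasic p) (ha : ∀ n, 0 < a n) (hla : ∀ n, l n + a n ≤ p n)
    (hN : Tendsto (fun n => (partialProd a n : ℝ)) atTop atTop) (t : ℝ) :
    lift p l a t ∈ digitBox p l a := by
  obtain ⟨h1, h2⟩ := lift_spec hp ha hla hN t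
  refine ⟨h1, fun n => ?_⟩
  rw [← h2]
  have := digit_lt_of_pos ha t n
  simp only [mem_Ico]
  omega

/-- Counted in cylinders of level `n`, lifting does not bring points closer: the shift cancels in
digit differences, and earlier differences are scaled by `p n ≥ a n`. -/
theorem floor_diff_le (hp : IsBasic p) (ha : ∀ n, 0 < a n) (hla : ∀ n, l n + a n ≤ p n)
    (hN : Tendsto (fun n => (partialProd a n : ℝ)) atTop atTop) {t u : ℝ}
    (ht : t ∈ Ico (0 : ℝ) 1) (hu : u ∈ Ico (0 : ℝ) 1) (htu : t ≤ u) (n : ℕ) :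
    ⌊u * partialProd a n⌋ - ⌊t * partialProd a n⌋ ≤
      ⌊lift p l a u * partialProd p n⌋ - ⌊lift p l a t * partialProd p n⌋ := by
  obtain ⟨ht1, ht2⟩ := lift_spec hp ha hla hN t
  obtain ⟨hu1, hu2⟩ := lift_spec hp ha hla hN u
  induction n with
  | zero =>
    simp [partialProd, floor_eq_zero_of_mem ht, floor_eq_zero_of_mem hu,
      floor_eq_zero_of_mem ht1, floor_eq_zero_of_mem hu1]
  | succ n ih =>
    have h0 : 0 ≤ ⌊u * partialProd a n⌋ - ⌊t * partialProd a n⌋ :=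
      sub_nonneg.2 (Int.floor_mono (mul_le_mul_of_nonneg_right htu (by positivity)))
    rw [floor_succ_of_pos ha, floor_succ_of_pos ha, floor_succ hp, floor_succ hp,
      ← congrFun ht2 n, ← congrFun hu2 n]
    have h1 : (a n : ℤ) ≤ p n := by have := hla n; omega
    have h2 : (a n : ℤ) * (⌊u * partialProd a n⌋ - ⌊t * partialProd a n⌋) ≤
        p n * (⌊lift p l a u * partialProd p n⌋ - ⌊lift p l a t * partialProd p n⌋) :=
      mul_le_mul h1 ih h0 (by omega)
    push_cast
    linarith

theorem sub_mul_lt (hp : IsBasic p) (ha : ∀ n, 0 < a n) (hla : ∀ n, l n + a n ≤ p n)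
    (hN : Tendsto (fun n => (partialProd a n : ℝ)) atTop atTop) {t u : ℝ}
    (ht : t ∈ Ico (0 : ℝ) 1) (hu : u ∈ Ico (0 : ℝ) 1) (htu : t ≤ u) (n : ℕ) :
    -- The `2` is the rounding loss, less than `1` for each of the two differences of floors.
    (u - t) * partialProd a n < (lift p l a u - lift p l a t) * partialProd p n + 2 := by
  have h : ((⌊u * partialProd a n⌋ : ℝ) - ⌊t * partialProd a n⌋) ≤
      ⌊lift p l a u * partialProd p n⌋ - ⌊lift p l a t * partialProd p n⌋ := by
    exact_mod_cast floor_diff_le hp ha hla hN ht hu htu n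
  have h1 := Int.lt_floor_add_one (u * partialProd a n)
  have h2 := Int.floor_le (t * partialProd a n)
  have h3 := Int.floor_le (lift p l a u * partialProd p n)
  have h4 := Int.lt_floor_add_one (lift p l a t * partialProd p n)
  linarith

theorem lift_lt_lift (hp : IsBasic p) (ha : ∀ n, 0 < a n) (hla : ∀ n, l n + a n ≤ p n)
    (hN : Tendsto (fun n => (partialProd a n : ℝ)) atTop atTop) {t u : ℝ}
    (ht : t ∈ Ico (0 : ℝ) 1) (hu : u ∈ Ico (0 : ℝ) 1) (htu : t < u) :
    lift p l a t < lift p l a u := by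
  obtain ⟨n, hn⟩ := (hN.eventually_gt_atTop (2 / (u - t))).exists
  rw [div_lt_iff₀ (sub_pos.2 htu)] at hn
  have h := sub_mul_lt hp ha hla hN ht hu htu.le n
  have hP : (0 : ℝ) < partialProd p n := by exact_mod_cast partialProd_pos hp n
  by_contra! hle
  nlinarith

theorem exists_scale (hp : IsBasic p) {r : ℝ} (h0 : 0 < r) (h1 : r < 1) :
    ∃ n, 1 / (partialProd p (n + 1) : ℝ) ≤ r ∧ r < 1 / partialProd p n := by
  classical
  have hex : ∃ n, 1 / (partialProd p n : ℝ) ≤ r :=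
    ((tendsto_inv_partialProd hp).eventually_le_const h0).exists
  have hne : Nat.find hex ≠ 0 := fun h => by
    have := Nat.find_spec hex
    rw [h] at this
    simp [partialProd] at this
    linarith
  obtain ⟨n, hn⟩ := Nat.exists_eq_succ_of_ne_zero hne
  refine ⟨n, ?_, not_le.1 (Nat.find_min hex (by omega))⟩
  have := Nat.find_spec hex
  rwa [hn] at this

theorem log_le_log_partialProd (ha : ∀ n, 0 < a n) (hap : ∀ n, a n ≤ p n)
    (n : ℕ) : Real.log (partialProd a n) ≤ Real.log (partialProd p n) :=
  Real.log_le_log (by exact_mod_cast partialProd_pos' ha n)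
    (by exact_mod_cast partialProd_mono_of_le hap n)

theorem log_partialProd_le_sub (hp : IsBasic p) (ha : ∀ n, 0 < a n) (hap : ∀ n, a n ≤ p n)
    (n : ℕ) : Real.log (partialProd p n) ≤ Real.log (partialProd p (n + 1)) - Real.log (a n) := by
  rw [log_partialProd_succ fun n => by have := hp n; omega]
  have := Real.log_le_log (by exact_mod_cast ha n) (show (a n : ℝ) ≤ p n by exact_mod_cast hap n)
  linarith

theorem log_partialProd_pos (hp : IsBasic p) {n : ℕ} (hn : 0 < n) :
    0 < Real.log (partialProd p n) := by
  refine Real.log_pos ?_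
  have h1 := two_pow_le_partialProd hp n
  have h2 := Nat.one_lt_two_pow hn.ne'
  exact_mod_cast lt_of_lt_of_le h2 h1

theorem log_partialProd_nonneg (a : ℕ → ℕ) (n : ℕ) : 0 ≤ Real.log (partialProd a n) :=
  Real.log_natCast_nonneg _

/-- Hölder estimate for the inverse of `lift`. Let `r` be the distance of the images and `1 / P (n +
1) ≤ r < 1 / P n`. Then `sub_mul_lt` at levels `n` and `n + 1` gives `(u - t) * A n ≤ 3` and `(u -
t) * A (n + 1) ≤ 3 * r * P (n + 1)`. The logarithms of these, weighted by `1 - s` and `s`, combine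
to exactly the expression bounded in `hB`. -/
theorem sub_le_mul_rpow (hp : IsBasic p) (ha : ∀ n, 0 < a n) (hla : ∀ n, l n + a n ≤ p n)
    (hN : Tendsto (fun n => (partialProd a n : ℝ)) atTop atTop) {s B : ℝ} (hs0 : 0 ≤ s)
    (hs1 : s ≤ 1)
    (hB : ∀ n, s * (Real.log (partialProd p (n + 1)) - Real.log (a n))
      - Real.log (partialProd a n) ≤ B) {t u : ℝ}
    (ht : t ∈ Ico (0 : ℝ) 1) (hu : u ∈ Ico (0 : ℝ) 1) (htu : t < u) :
    u - t ≤ 3 * Real.exp B * (lift p l a u - lift p l a t) ^ s := by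
  set r := lift p l a u - lift p l a t with hr
  have hr0 : 0 < r := sub_pos.2 (lift_lt_lift hp ha hla hN ht hu htu)
  have hr1 : r < 1 := by
    have h1 := (lift_spec hp ha hla hN u).1.2
    have h2 := (lift_spec hp ha hla hN t).1.1
    linarith
  have hut : 0 < u - t := sub_pos.2 htu
  obtain ⟨n, hn1, hn2⟩ := exists_scale hp hr0 hr1
  have hP : ∀ n, (0 : ℝ) < partialProd p n := fun n => by exact_mod_cast partialProd_pos hp n
  have hA : ∀ n, (0 : ℝ) < partialProd a n := fun n => by exact_mod_cast partialProd_pos' ha n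
  rw [div_le_iff₀ (hP _)] at hn1
  rw [lt_div_iff₀ (hP _)] at hn2
  have e1 : (u - t) * partialProd a n ≤ 3 := by
    have := sub_mul_lt hp ha hla hN ht hu htu.le n
    linarith
  have e2 : (u - t) * partialProd a (n + 1) ≤ 3 * (r * partialProd p (n + 1)) := by
    have := sub_mul_lt hp ha hla hN ht hu htu.le (n + 1)
    linarith
  have f1 := Real.log_le_log (mul_pos hut (hA _)) e1
  have f2 := Real.log_le_log (mul_pos hut (hA _)) e2
  rw [Real.log_mul hut.ne' (hA _).ne'] at f1 f2
  rw [Real.log_mul (by norm_num) (mul_pos hr0 (hP _)).ne', Real.log_mul hr0.ne' (hP _).ne',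
    log_partialProd_succ ha] at f2
  have hBn := hB n
  rw [← Real.log_le_log_iff hut (by positivity), Real.log_mul (by positivity) (by positivity),
    Real.log_mul (by norm_num) (by positivity), Real.log_exp, Real.log_rpow hr0]
  nlinarith [mul_le_mul_of_nonneg_left f1 (sub_nonneg.2 hs1), mul_le_mul_of_nonneg_left f2 hs0]

theorem le_dimH_digitBox (hp : IsBasic p) (ha : ∀ n, 0 < a n) (hla : ∀ n, l n + a n ≤ p n)
    {s : ℝ≥0} (hs0 : 0 < s)
    (hs : (s : ℝ≥0∞) < liminf (fun n => ENNReal.ofReal (lowerRatio p a n)) atTop) :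
    (s : ℝ≥0∞) ≤ dimH (digitBox p l a) := by
  have hap : ∀ n, a n ≤ p n := fun n => by have := hla n; omega
  have hev : ∀ᶠ n in atTop, (s : ℝ) * (Real.log (partialProd p (n + 1)) - Real.log (a n))
      ≤ Real.log (partialProd a n) ∧ 0 < n := by
    filter_upwards [eventually_lt_of_lt_liminf hs, eventually_gt_atTop 0] with n hn hn0
    have h1 : (s : ℝ) ≤ lowerRatio p a n := by
      have : ENNReal.ofReal s < ENNReal.ofReal (lowerRatio p a n) := by simpa using hn
      exact (ENNReal.ofReal_lt_ofReal_iff_of_nonneg s.2).1 this |>.le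
    have h2 := (log_partialProd_pos hp hn0).trans_le (log_partialProd_le_sub hp ha hap n)
    exact ⟨(le_div_iff₀ h2).1 h1, hn0⟩
  -- The ratio cannot exceed `1`, because `log (A n) ≤ log (P n) ≤ log (P (n + 1)) - log (a n)`.
  have hs1 : (s : ℝ) ≤ 1 := by
    obtain ⟨n, hn, hn0⟩ := hev.exists
    have h1 := log_partialProd_pos hp hn0
    have h2 := log_partialProd_le_sub hp ha hap n
    have h3 := log_le_log_partialProd ha hap n
    by_contra! h
    nlinarith
  have hN : Tendsto (fun n => (partialProd a n : ℝ)) atTop atTop := by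
    refine tendsto_atTop_mono' _ ?_ ((tendsto_log_partialProd hp).const_mul_atTop
      (show (0 : ℝ) < s from hs0))
    filter_upwards [hev] with n hn
    have h2 := log_partialProd_le_sub hp ha hap n
    have h3 := Real.log_le_self (x := partialProd a n) (by positivity)
    nlinarith [mul_le_mul_of_nonneg_left h2 s.2]
  -- The expression is eventually at most `0`; the finitely many exceptions go into the Hölder
  -- constant.
  obtain ⟨B, hB⟩ : BddAbove (range fun n => (s : ℝ) * (Real.log (partialProd p (n + 1))
      - Real.log (a n)) - Real.log (partialProd a n)) :=
    (isBoundedUnder_of_eventually_le (a := 0) (hev.mono fun n hn => by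
      linarith [hn.1])).bddAbove_range
  have hB' := fun n => hB (mem_range_self n)
  have hlt := fun {t u : ℝ} (ht : t ∈ Ico (0 : ℝ) 1) (hu : u ∈ Ico (0 : ℝ) 1) (h : t < u) =>
    lift_lt_lift hp ha hla hN ht hu h
  have hinj : InjOn (lift p l a) (Ico 0 1) :=
    StrictMonoOn.injOn fun t ht u hu h => hlt ht hu h
  have hdist : ∀ t ∈ Ico (0 : ℝ) 1, ∀ u ∈ Ico (0 : ℝ) 1,
      dist t u ≤ 3 * Real.exp B * dist (lift p l a t) (lift p l a u) ^ (s : ℝ) := by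
    have key : ∀ t ∈ Ico (0 : ℝ) 1, ∀ u ∈ Ico (0 : ℝ) 1, t < u →
        dist t u ≤ 3 * Real.exp B * dist (lift p l a t) (lift p l a u) ^ (s : ℝ) := by
      intro t ht u hu h
      rw [dist_comm, dist_comm (lift p l a t), Real.dist_eq, Real.dist_eq,
        abs_of_pos (sub_pos.2 h), abs_of_pos (sub_pos.2 (hlt ht hu h))]
      exact sub_le_mul_rpow hp ha hla hN s.2 hs1 hB' ht hu h
    intro t ht u hu
    rcases lt_trichotomy t u with h | rfl | h
    · exact key t ht u hu h
    · rw [dist_self, dist_self]; positivity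
    · rw [dist_comm, dist_comm (lift p l a t)]; exact key u hu t ht h
  set g := Function.invFunOn (lift p l a) (Ico 0 1) with hg
  have hgl : ∀ t ∈ Ico (0 : ℝ) 1, g (lift p l a t) = t := fun t ht => hinj.leftInvOn_invFunOn ht
  have hH : HolderOnWith (3 * Real.exp B).toNNReal s g (lift p l a '' Ico 0 1) := by
    rintro _ ⟨t, ht, rfl⟩ _ ⟨u, hu, rfl⟩
    rw [hgl t ht, hgl u hu, edist_dist, edist_dist,
      ENNReal.ofReal_rpow_of_nonneg dist_nonneg s.coe_nonneg]
    refine (ENNReal.ofReal_le_ofReal (hdist t ht u hu)).trans ?_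
    rw [ENNReal.ofReal_mul (by positivity)]
    exact le_rfl
  have himg : g '' (lift p l a '' Ico 0 1) = Ico 0 1 := by
    rw [image_image]
    exact (image_congr hgl).trans (image_id _)
  have h1 := hH.dimH_image_le hs0
  have h2 : dimH (Ico (0 : ℝ) 1) = 1 := by
    rw [Real.dimH_of_nonempty_interior (by rw [interior_Ico]; exact nonempty_Ioo.2 zero_lt_one)]
    simp
  rw [himg, h2, ENNReal.le_div_iff_mul_le (by simp [hs0.ne']) (by simp), one_mul] at h1
  refine h1.trans (dimH_mono ?_)
  rintro _ ⟨t, _, rfl⟩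
  exact lift_mem_digitBox hp ha hla hN t

theorem dimH_digitBox (hp : IsBasic p) (ha : ∀ n, 0 < a n) (hla : ∀ n, l n + a n ≤ p n) :
    dimH (digitBox p l a) = liminf (fun n => ENNReal.ofReal (lowerRatio p a n)) atTop := by
  refine le_antisymm (dimH_digitBox_le_liminf hp ha hla) (le_of_forall_lt fun c hc => ?_)
  obtain ⟨s, hs1, hs2⟩ := ENNReal.lt_iff_exists_nnreal_btwn.1 hc
  exact hs1.trans_le (le_dimH_digitBox hp ha hla
    (by exact_mod_cast (zero_le).trans_lt hs1) hs2)

end Lift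

end CantorSeries

namespace CantorSeries

/-! ### Upper box dimension of a digit box -/

section UpperBox

variable {p l a : ℕ → ℕ}

theorem partialProd_monotone (ha : ∀ n, 0 < a n) : Monotone (partialProd a) :=
  monotone_nat_of_le_succ fun n => by
    rw [partialProd_succ]; exact Nat.le_mul_of_pos_right _ (ha n)

/-- For `1 / P (n + 1) ≤ δ < 1 / P n`, each of the `A n` prefixes needs `k` balls, where both `k ≤ a
n` and `k ≤ 2 / (δ * P n)`. The better bound gives `log (A n * k) ≤ log 2 + b * log (1 / δ)` for any
`b` above the upper limit, once `δ` is small. Passing to `c > b` absorbs the constant `log 2` and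
the finite set. -/
theorem upperBoxDim_digitBox_union_le (hp : IsBasic p) (ha : ∀ n, 0 < a n)
    (hla : ∀ n, l n + a n ≤ p n) {F : Set ℝ} (hF : F.Finite) :
    upperBoxDim (digitBox p l a ∪ F) ≤
      limsup (fun n => ENNReal.ofReal (upperRatio p a n)) atTop := by
  by_contra! hlt
  obtain ⟨c, hc1, hc2⟩ := ENNReal.lt_iff_exists_nnreal_btwn.1 hlt
  obtain ⟨b, hb1, hb2⟩ := ENNReal.lt_iff_exists_nnreal_btwn.1 hc1
  have hbc : (b : ℝ) < c := by exact_mod_cast hb2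
  refine hc2.not_ge (limsup_le_of_le (by isBoundedDefault) ?_)
  have hap : ∀ n, a n ≤ p n := fun n => by have := hla n; omega
  have hp0 : ∀ n, 0 < p n := fun n => by have := hp n; omega
  have hP : ∀ n, (0 : ℝ) < partialProd p n := fun n => by exact_mod_cast partialProd_pos hp n
  have hev : ∀ᶠ n in atTop, Real.log (partialProd a (n + 1)) ≤
      b * (Real.log (partialProd p n) + Real.log (a n)) ∧ 0 < n := by
    filter_upwards [eventually_lt_of_limsup_lt hb1, eventually_gt_atTop 0] with n hn hn0
    have h1 : upperRatio p a n ≤ b := by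
      by_contra! h
      exact hn.not_ge (by simpa using ENNReal.ofReal_le_ofReal h.le)
    have h2 : 0 < Real.log (partialProd p n) + Real.log (a n) :=
      add_pos_of_pos_of_nonneg (log_partialProd_pos hp hn0) (Real.log_natCast_nonneg _)
    exact ⟨(div_le_iff₀ h2).1 h1, hn0⟩
  obtain ⟨n₀, hn₀⟩ := eventually_atTop.1 hev
  obtain ⟨f, hf⟩ : ∃ f : ℕ, F.encard = f := ⟨_, hF.encard_eq_coe⟩
  have hδ₀ : (0 : ℝ≥0) < 1 / partialProd p n₀ := by
    rw [← NNReal.coe_pos]; simpa using partialProd_pos hp n₀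
  filter_upwards [Ioo_mem_nhdsGT hδ₀, Ioo_mem_nhdsGT (zero_lt_one' ℝ≥0),
    tendsto_log_one_div_nhdsGT.eventually_ge_atTop
      ((Real.log (1 + f) + Real.log 2) / ((c : ℝ) - b))] with δ hδ1 hδ2 hδ3
  have hδ : (0 : ℝ) < δ := hδ2.1
  obtain ⟨n, hn1, hn2⟩ := exists_scale hp hδ (by exact_mod_cast hδ2.2)
  have hn : n₀ ≤ n := by
    have h1 : (δ : ℝ) < 1 / partialProd p n₀ := by
      have := hδ1.2
      rw [← NNReal.coe_lt_coe] at this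
      simpa using this
    have h2 := (one_div_lt_one_div (hP _) (hP _)).1 (hn1.trans_lt h1)
    by_contra! h
    have h3 : (partialProd p (n + 1) : ℝ) ≤ partialProd p n₀ := by
      exact_mod_cast partialProd_monotone hp0 (by omega : n + 1 ≤ n₀)
    linarith
  obtain ⟨hr, hn0⟩ := hn₀ n hn
  set L := Real.log (1 / (δ : ℝ)) with hL
  have hL0 : 0 < L := Real.log_pos (by
    rw [one_div]; exact (one_lt_inv₀ hδ).2 (by exact_mod_cast hδ2.2))
  set k := ⌈(a n : ℝ) / partialProd p (n + 1) / δ⌉₊ with hk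
  have ha' : (0 : ℝ) < a n := by exact_mod_cast ha n
  have hA : (0 : ℝ) < partialProd a n := by exact_mod_cast partialProd_pos' ha n
  have hk0 : 0 < k := Nat.ceil_pos.2 (div_pos (div_pos ha' (hP _)) hδ)
  have hk0' : (0 : ℝ) < k := by exact_mod_cast hk0
  have hka : (k : ℝ) ≤ a n := by
    refine Nat.cast_le.2 (Nat.ceil_le.2 ?_)
    rw [div_div, div_le_iff₀ (mul_pos (hP _) hδ)]
    rw [div_le_iff₀ (hP _)] at hn1
    nlinarith
  have hkL : (k : ℝ) ≤ 2 * (1 / δ / partialProd p n) := by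
    have h1 : (a n : ℝ) / partialProd p (n + 1) / δ ≤ 1 / δ / partialProd p n := by
      rw [div_div, div_div, div_le_div_iff₀ (mul_pos (hP _) hδ) (mul_pos hδ (hP _)),
        partialProd_succ]
      have h2 : (a n : ℝ) ≤ p n := by exact_mod_cast hap n
      have h3 := mul_le_mul_of_nonneg_left h2 (mul_pos hδ (hP n)).le
      push_cast; linarith
    have h2 : 1 ≤ 1 / δ / (partialProd p n : ℝ) := by
      rw [div_div, le_div_iff₀ (mul_pos hδ (hP _))]
      rw [lt_div_iff₀ (hP _)] at hn2
      linarith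
    have h3 := Nat.ceil_lt_add_one (div_pos (div_pos ha' (hP (n + 1))) hδ).le
    rw [← hk] at h3
    linarith
  have hcov : Metric.externalCoveringNumber δ (digitBox p l a ∪ F) ≤
      (partialProd a n * k + f : ℕ) := by
    refine (externalCoveringNumber_union_le δ _ _).trans ?_
    rw [hf]
    push_cast
    gcongr
    exact_mod_cast externalCoveringNumber_digitBox_le hp (fun n _ => hla n) n hδ2.1 (ha n)
  refine (boxRatio_le hδ2.1 hδ2.2 (by have := Nat.mul_pos (partialProd_pos' ha n) hk0; omega)
    hcov).trans ?_
  rw [← ENNReal.ofReal_coe_nnreal]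
  refine ENNReal.ofReal_le_ofReal ((div_le_iff₀ hL0).2 ?_)
  have hm : Real.log ((partialProd a n * k + f : ℕ) : ℝ) ≤
      Real.log (1 + f) + (Real.log (partialProd a n) + Real.log k) := by
    rw [← Real.log_mul hA.ne' hk0'.ne', ← Real.log_mul (by positivity) (by positivity)]
    refine Real.log_le_log (Nat.cast_pos.2 (Nat.add_pos_left
      (Nat.mul_pos (partialProd_pos' ha n) hk0) f)) ?_
    have h1 : (1 : ℝ) ≤ partialProd a n * k := by
      exact_mod_cast Nat.mul_pos (partialProd_pos' ha n) hk0
    have h2 : (0 : ℝ) ≤ f := by positivity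
    push_cast
    nlinarith
  have g1 : Real.log k ≤ Real.log (a n) := Real.log_le_log hk0' hka
  have g2 : Real.log k ≤ Real.log 2 + (L - Real.log (partialProd p n)) := by
    rw [hL, ← Real.log_div (by positivity) (hP _).ne', ← Real.log_mul (by norm_num)
      (div_pos (by positivity) (hP n)).ne']
    exact Real.log_le_log hk0' hkL
  have g3 : Real.log (1 + f) + Real.log 2 ≤ (c - b) * L := by
    have := (div_le_iff₀ (sub_pos.2 hbc)).1 hδ3
    linarith
  have g4 := log_le_log_partialProd ha hap n
  have g5 : (0 : ℝ) < Real.log 2 := Real.log_pos (by norm_num)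
  have g6 : 0 ≤ (b : ℝ) := b.2
  rw [log_partialProd_succ ha] at hr
  -- If `P n * a n ≤ 1 / δ`, then `k ≤ a n` and `hr` suffice. Otherwise the other bound on `k` is
  -- used, with `hr` if `b ≤ 1` and with `A n ≤ P n` if `b ≥ 1`.
  have main : Real.log (partialProd a n) + Real.log k ≤ Real.log 2 + b * L := by
    rcases le_total (Real.log (partialProd p n) + Real.log (a n)) L with h | h
    · have := mul_le_mul_of_nonneg_left h g6
      linarith
    · rcases le_total (b : ℝ) 1 with h1 | h1
      · nlinarith [mul_nonneg (sub_nonneg.2 h1) (sub_nonneg.2 h)]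
      · nlinarith
  linarith

end UpperBox

/-! ### Comparison of the limits of logarithmic ratios -/

section Ratios

theorem liminf_ofReal_le_of_le_add {u v ε : ℕ → ℝ} (h : ∀ᶠ n in atTop, u n ≤ v n + ε n)
    (hε : Tendsto ε atTop (𝓝 0)) :
    liminf (fun n => ENNReal.ofReal (u n)) atTop ≤ liminf (fun n => ENNReal.ofReal (v n)) atTop := by
  have h1 : Tendsto (fun n => ENNReal.ofReal (ε n)) atTop (𝓝 0) := by
    simpa using ENNReal.tendsto_ofReal hε
  rw [← ENNReal.liminf_add_of_right_tendsto_zero h1 fun n => ENNReal.ofReal (v n)]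
  refine liminf_le_liminf (h.mono fun n hn => ?_)
  exact (ENNReal.ofReal_le_ofReal hn).trans ENNReal.ofReal_add_le

variable {p a : ℕ → ℕ}

theorem LogNegligible.tendsto_div (hp : IsBasic p) (h : LogNegligible p) :
    Tendsto (fun n => Real.log (p n) / Real.log (partialProd p n)) atTop (𝓝 0) := by
  -- With `y` the given ratio over `log (P (n + 1))`, the ratio over `log (P n)` is `y / (1 - y)`.
  have h1 : Tendsto (fun n => (Real.log (p n) / Real.log (partialProd p (n + 1))) /
      (1 - Real.log (p n) / Real.log (partialProd p (n + 1)))) atTop (𝓝 (0 / (1 - 0))) :=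
    h.div (tendsto_const_nhds.sub h) (by norm_num)
  rw [zero_div] at h1
  refine h1.congr' ?_
  filter_upwards [eventually_gt_atTop 0] with n hn
  have h2 := log_partialProd_pos hp hn
  have h3 : 0 ≤ Real.log (p n) := Real.log_natCast_nonneg _
  rw [log_partialProd_succ fun n => by have := hp n; omega]
  have h4 : Real.log (partialProd p n) + Real.log (p n) ≠ 0 := by positivity
  rw [one_sub_div h4, add_sub_cancel_right, div_div_div_cancel_right₀ h4]

/-- The two denominators differ by at most `log (p n)`, so the ratios differ by at most `log (p n) /
log (P n)`, which vanishes in the limit. -/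
theorem liminf_lowerRatio_eq (hp : IsBasic p) (ha : ∀ n, 0 < a n) (hap : ∀ n, a n ≤ p n)
    (h : LogNegligible p) :
    liminf (fun n => ENNReal.ofReal (lowerRatio p a n)) atTop =
      liminf (fun n => ENNReal.ofReal
        (Real.log (partialProd a n) / Real.log (partialProd p n))) atTop := by
  refine le_antisymm (liminf_ofReal_le_of_le_add (ε := 0) ?_ tendsto_const_nhds)
    (liminf_ofReal_le_of_le_add ?_ (h.tendsto_div hp))
  · filter_upwards [eventually_gt_atTop 0] with n hn
    rw [Pi.zero_apply, add_zero]
    exact div_le_div_of_nonneg_left (log_partialProd_nonneg a n) (log_partialProd_pos hp hn)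
      (log_partialProd_le_sub hp ha hap n)
  · filter_upwards [eventually_gt_atTop 0] with n hn
    have h1 := log_partialProd_pos hp hn
    have h2 := log_partialProd_le_sub hp ha hap n
    have h3 := log_le_log_partialProd ha hap n
    have h4 : Real.log (partialProd p (n + 1)) - Real.log (a n) ≤
        Real.log (partialProd p n) + Real.log (p n) := by
      rw [log_partialProd_succ fun n => by have := hp n; omega]
      linarith [Real.log_natCast_nonneg (a n)]
    have h5 := log_partialProd_nonneg a n
    have h6 : 0 ≤ Real.log (p n) := Real.log_natCast_nonneg _
    unfold lowerRatio
    generalize Real.log (partialProd p (n + 1)) - Real.log (a n) = D at *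
    generalize Real.log (partialProd p n) = P at *
    generalize Real.log (partialProd a n) = x at *
    generalize Real.log (p n) = e at *
    have hD : 0 < D := by linarith
    have key : x * D ≤ x * P + D * e := by nlinarith [mul_nonneg h6 (by linarith : 0 ≤ D - x)]
    rw [div_add_div _ _ hD.ne' h1.ne', div_le_div_iff₀ h1 (mul_pos hD h1)]
    nlinarith

/-- Dropping the first `m` factors changes numerator and denominator by constants, and the ratio by
at most `log (P m) / log (P n)`. -/
theorem liminf_log_Ico_eq (hp : IsBasic p) (ha : ∀ n, 0 < a n) (hap : ∀ n, a n ≤ p n) (m : ℕ) :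
    liminf (fun n => ENNReal.ofReal
        (Real.log (partialProd a n) / Real.log (partialProd p n))) atTop =
      liminf (fun n => ENNReal.ofReal
        (Real.log (∏ j ∈ Finset.Ico m n, a j : ℕ) /
          Real.log (∏ j ∈ Finset.Ico m n, p j : ℕ))) atTop := by
  have hp0 : ∀ n, 0 < p n := fun n => by have := hp n; omega
  have hε : Tendsto (fun n => Real.log (partialProd p m) / Real.log (partialProd p n))
      atTop (𝓝 0) := (tendsto_log_partialProd hp).const_div_atTop _
  have hsplit : ∀ {b : ℕ → ℕ}, (∀ n, 0 < b n) → ∀ n, m ≤ n → Real.log (partialProd b n) =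
      Real.log (partialProd b m) + Real.log (∏ j ∈ Finset.Ico m n, b j : ℕ) := by
    intro b hb n hn
    have h1 : (∏ j ∈ Finset.Ico m n, b j) ≠ 0 := Finset.prod_ne_zero_iff.2 fun j _ => (hb j).ne'
    have h2 := (partialProd_pos' hb m).ne'
    rw [← Real.log_mul (by exact_mod_cast h2) (by exact_mod_cast h1), ← Nat.cast_mul]
    congr 2
    exact (Finset.prod_range_mul_prod_Ico b hn).symm
  have hfacts : ∀ n, m < n →
      Real.log (∏ j ∈ Finset.Ico m n, a j : ℕ) ≤ Real.log (∏ j ∈ Finset.Ico m n, p j : ℕ) ∧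
      0 < Real.log (∏ j ∈ Finset.Ico m n, p j : ℕ) := by
    intro n hn
    have h1 : 0 < ∏ j ∈ Finset.Ico m n, a j := Finset.prod_pos fun j _ => ha j
    refine ⟨Real.log_le_log (by exact_mod_cast h1)
      (Nat.cast_le.2 (Finset.prod_le_prod' fun j _ => hap j)), Real.log_pos ?_⟩
    have h2 : p m ∣ ∏ j ∈ Finset.Ico m n, p j :=
      Finset.dvd_prod_of_mem _ (Finset.mem_Ico.2 ⟨le_rfl, hn⟩)
    have h3 := Nat.le_of_dvd (Finset.prod_pos fun j _ => hp0 j) h2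
    have h4 := hp m
    exact_mod_cast (by omega : 1 < ∏ j ∈ Finset.Ico m n, p j)
  have hc := log_le_log_partialProd ha hap m
  have hc0 := log_partialProd_nonneg a m
  refine le_antisymm (liminf_ofReal_le_of_le_add ?_ hε) (liminf_ofReal_le_of_le_add ?_ hε)
  all_goals
    filter_upwards [eventually_gt_atTop m] with n hn
    obtain ⟨h1, h2⟩ := hfacts n hn
    have h3 : 0 ≤ Real.log (∏ j ∈ Finset.Ico m n, a j : ℕ) := Real.log_natCast_nonneg _
    rw [hsplit ha n hn.le, hsplit hp0 n hn.le]
    generalize Real.log (∏ j ∈ Finset.Ico m n, a j : ℕ) = x at *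
    generalize Real.log (∏ j ∈ Finset.Ico m n, p j : ℕ) = X at *
    generalize Real.log (partialProd a m) = c at *
    generalize Real.log (partialProd p m) = C at *
    have hX : 0 < C + X := by linarith
  · rw [← sub_le_iff_le_add, ← sub_div, div_le_div_iff₀ hX h2]
    nlinarith
  · rw [← add_div, div_le_div_iff₀ h2 hX]
    nlinarith

/-- `EReal.toENNReal` is monotone and continuous, so it commutes with both limits. -/
theorem BalancedCounts.liminf_eq_limsup (h : BalancedCounts p a) :
    liminf (fun n => ENNReal.ofReal (lowerRatio p a n)) atTop =
      limsup (fun n => ENNReal.ofReal (upperRatio p a n)) atTop := by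
  have hm : Monotone EReal.toENNReal := fun _ _ h => EReal.toENNReal_le_toENNReal h
  have h1 := congrArg EReal.toENNReal h
  rw [hm.map_liminf_of_continuousAt _ EReal.continuous_toENNReal.continuousAt
      (by isBoundedDefault) (by isBoundedDefault),
    hm.map_limsup_of_continuousAt _ EReal.continuous_toENNReal.continuousAt
      (by isBoundedDefault) (by isBoundedDefault)] at h1
  exact h1

end Ratios

end CantorSeries

namespace CantorSeries

/-! ### Measure and dimensions of the level set -/

section LevelSet

variable {p q : ℕ → ℕ} {w : ℝ}

theorem digitBox_eq_empty {p l a : ℕ → ℕ} {n : ℕ} (h : a n = 0) : digitBox p l a = ∅ :=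
  eq_empty_of_forall_notMem fun x hx => by
    have := hx.2 n
    simp [h] at this

theorem measurableSet_levelSet (hp : IsBasic p) (hq : IsBasic q) (hw : w ∈ Ioo (0 : ℝ) 1) :
    MeasurableSet (levelSet p q w) := by
  obtain ⟨F, hF, h⟩ := exists_levelSet_eq hp hq hw
  rw [h]
  exact (measurableSet_digitBox _ _ _).union hF.measurableSet

theorem volume_levelSet (hp : IsBasic p) (hq : IsBasic q) (hw : w ∈ Ioo (0 : ℝ) 1) :
    volume (levelSet p q w) =
      volume (digitBox p (infDigit q w) (digitCount p q (infDigit q w))) := by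
  obtain ⟨F, hF, h⟩ := exists_levelSet_eq hp hq hw
  rw [h]
  refine le_antisymm ((measure_union_le _ _).trans ?_) (measure_mono subset_union_left)
  rw [hF.measure_zero, add_zero]

theorem dimH_levelSet (hp : IsBasic p) (hq : IsBasic q) (hw : w ∈ Ioo (0 : ℝ) 1) :
    dimH (levelSet p q w) =
      dimH (digitBox p (infDigit q w) (digitCount p q (infDigit q w))) := by
  obtain ⟨F, hF, h⟩ := exists_levelSet_eq hp hq hw
  rw [h, dimH_union, hF.dimH_zero]
  exact max_eq_left bot_le

theorem tendsto_prod_volume_levelSet (hp : IsBasic p) (hq : IsBasic q)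
    (hw : w ∈ Ioo (0 : ℝ) 1) :
    Tendsto (fun n => ∏ j ∈ Finset.range n,
      (digitCount p q (infDigit q w) j : ℝ≥0∞) / (p j : ℝ≥0∞)) atTop
      (𝓝 (volume (levelSet p q w))) := by
  rw [volume_levelSet hp hq hw]
  exact tendsto_prod_volume_digitBox hp fun n hn =>
    add_digitCount_le hq (infDigit_lt hq) hn

theorem dimH_levelSet_of_digitCount_ne_zero (hp : IsBasic p) (hq : IsBasic q)
    (hw : w ∈ Ioo (0 : ℝ) 1) (h0 : ∀ n, digitCount p q (infDigit q w) n ≠ 0) :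
    dimH (levelSet p q w) = liminf (fun n => ENNReal.ofReal
      (lowerRatio p (digitCount p q (infDigit q w)) n)) atTop := by
  rw [dimH_levelSet hp hq hw]
  exact dimH_digitBox hp (fun n => Nat.pos_of_ne_zero (h0 n)) fun n =>
    add_digitCount_le hq (infDigit_lt hq) (h0 n)

theorem digitCount_le (hq : IsBasic q) {D : ℕ → ℕ} (hD : ∀ n, D n < q n) (n : ℕ) :
    digitCount p q D n ≤ p n := by
  by_cases h : digitCount p q D n = 0
  · omega
  · have := add_digitCount_le hq hD h
    omega

theorem dimH_levelSet_of_mem_uniqueSet (hp : IsBasic p) (hq : IsBasic q)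
    (hw : w ∈ Ioo (0 : ℝ) 1) (hU : w ∈ uniqueSet q) (hneg : LogNegligible p) :
    dimH (levelSet p q w) = liminf (fun n => ENNReal.ofReal
      (Real.log (partialProd (omega p q w) n) / Real.log (partialProd p n))) atTop := by
  have hD : infDigit q w = digit q w := infDigit_eq_digit hU
  by_cases h0 : ∀ n, omega p q w n ≠ 0
  · rw [dimH_levelSet_of_digitCount_ne_zero hp hq hw (by rwa [hD, ← omega_eq_digitCount]), hD,
      ← omega_eq_digitCount]
    exact liminf_lowerRatio_eq hp (fun n => Nat.pos_of_ne_zero (h0 n))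
      (digitCount_le hq (digit_lt hq w)) hneg
  · push Not at h0
    obtain ⟨m, hm⟩ := h0
    rw [dimH_levelSet hp hq hw, digitBox_eq_empty (n := m) (by rw [hD]; exact hm), dimH_empty]
    -- If a count vanishes, the set is empty and the products are eventually `0`; the convention
    -- `log 0 = 0` makes the ratios `0` as well.
    refine (Tendsto.liminf_eq (tendsto_const_nhds.congr' ?_)).symm
    filter_upwards [eventually_gt_atTop m] with n hn
    have h1 : partialProd (omega p q w) n = 0 :=
      Finset.prod_eq_zero (Finset.mem_range.2 hn) hm
    simp [h1]

/-- The digit counts of the expansion with infinitely many nonzero digits, for a number with a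
terminating expansion. -/
theorem digitCount_infDigit (hq : IsBasic q) {M : ℕ}
    (hM : IsGreatest {t | 0 < digit q w t} M) (hqp : ∀ n, M < n → q n ≤ p n)
    (hMp : digit q w M ≤ p M) (n : ℕ) :
    digitCount p q (infDigit q w) n =
      if n < M then omega p q w n else if n = M then 1 else p n - q n + 1 := by
  have h1 := hq n
  have h2 := digit_lt hq w n
  have h3 : 0 < digit q w M := hM.1
  have h4 := infDigit_of_isGreatest hM n
  rcases lt_trichotomy n M with h | rfl | h
  · rw [if_pos h] at h4 ⊢
    rw [omega_eq_digitCount, digitCount, digitCount, h4]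
  -- At the last nonzero position the lowered digit is at most `q M - 2` and, as `digit q w M ≤ p
  -- M`, below `p M`: exactly one choice.
  · simp only [lt_irrefl, if_false, if_true] at h4 ⊢
    rw [digitCount, h4, if_neg (by omega), if_pos (by omega)]
  · rw [if_neg (by omega), if_neg (by omega)] at h4 ⊢
    have := hqp n h
    rw [digitCount, h4, if_neg (by omega), if_neg (by omega)]

theorem tendsto_prod_volume_levelSet_of_isGreatest (hp : IsBasic p) (hq : IsBasic q)
    (hw : w ∈ Ioo (0 : ℝ) 1) {M : ℕ} (hM : IsGreatest {t | 0 < digit q w t} M)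
    (hqp : ∀ n, M < n → q n ≤ p n) (hMp : digit q w M ≤ p M) :
    Tendsto (fun n => (∏ j ∈ Finset.range M, (omega p q w j : ℝ≥0∞) / (p j : ℝ≥0∞)) *
          (1 / (p M : ℝ≥0∞)) *
          ∏ j ∈ Finset.Ico (M + 1) n, ((p j - q j + 1 : ℕ) : ℝ≥0∞) / (p j : ℝ≥0∞)) atTop
        (𝓝 (volume (levelSet p q w))) := by
  refine (tendsto_prod_volume_levelSet hp hq hw).congr' ?_
  have hc := digitCount_infDigit hq hM hqp hMp
  filter_upwards [eventually_ge_atTop (M + 1)] with n hn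
  rw [← Finset.prod_range_mul_prod_Ico _ hn, Finset.prod_range_succ]
  congr 1
  · congr 1
    · exact Finset.prod_congr rfl fun j hj => by rw [hc, if_pos (Finset.mem_range.1 hj)]
    · rw [hc]; simp
  · refine Finset.prod_congr rfl fun j hj => ?_
    have := (Finset.mem_Ico.1 hj).1
    rw [hc, if_neg (by omega), if_neg (by omega)]

theorem dimH_levelSet_of_isGreatest (hp : IsBasic p) (hq : IsBasic q)
    (hw : w ∈ Ioo (0 : ℝ) 1) {M : ℕ} (hM : IsGreatest {t | 0 < digit q w t} M)
    (hqp : ∀ n, M < n → q n ≤ p n) (hMp : digit q w M ≤ p M)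
    (hlt : ∀ j, j < M → digit q w j < p j) (hneg : LogNegligible p) :
    dimH (levelSet p q w) =
      liminf (fun n => ENNReal.ofReal
        (Real.log (∏ j ∈ Finset.Ico (M + 1) n, (p j - q j + 1) : ℕ) /
          Real.log (∏ j ∈ Finset.Ico (M + 1) n, p j : ℕ))) atTop := by
  have hc := digitCount_infDigit hq hM hqp hMp
  have h0 : ∀ n, digitCount p q (infDigit q w) n ≠ 0 := fun n => by
    rw [hc]
    split_ifs with h1 h2
    · have := hlt n h1
      unfold omega
      split_ifs <;> omega
    · exact one_ne_zero
    · omega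
  have hle := digitCount_le (p := p) hq (infDigit_lt hq (w := w))
  have hpos := fun n => Nat.pos_of_ne_zero (h0 n)
  rw [dimH_levelSet_of_digitCount_ne_zero hp hq hw h0, liminf_lowerRatio_eq hp hpos hle hneg,
    liminf_log_Ico_eq hp hpos hle (M + 1)]
  refine congrArg (fun f => liminf f atTop) (funext fun n => ?_)
  rw [Finset.prod_congr rfl fun j hj => ?_]
  have := (Finset.mem_Ico.1 hj).1
  rw [hc, if_neg (by omega), if_neg (by omega)]

/-- If all counts are positive, the balance condition equates the formula for the Hausdorff
dimension with the upper box bound. If one count is zero, the box is empty and the level set is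
finite. -/
theorem upperBoxDim_levelSet_le (hp : IsBasic p) (hq : IsBasic q) (hw : w ∈ Ioo (0 : ℝ) 1)
    (hbal : BalancedCounts p fun n => (digitSet p q w n).card) :
    upperBoxDim (levelSet p q w) ≤ dimH (levelSet p q w) := by
  obtain ⟨F, hF, h⟩ := exists_levelSet_eq hp hq hw
  by_cases h0 : ∀ n, digitCount p q (infDigit q w) n ≠ 0
  · rw [show (fun n => (digitSet p q w n).card) = digitCount p q (infDigit q w) from
      funext fun n => card_digitSet hq (h0 n)] at hbal
    rw [dimH_levelSet_of_digitCount_ne_zero hp hq hw h0, hbal.liminf_eq_limsup, h]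
    exact upperBoxDim_digitBox_union_le hp (fun n => Nat.pos_of_ne_zero (h0 n))
      (fun n => add_digitCount_le hq (infDigit_lt hq) (h0 n)) hF
  · push Not at h0
    obtain ⟨m, hm⟩ := h0
    rw [h, digitBox_eq_empty hm, empty_union, upperBoxDim_finite hF]
    exact bot_le

end LevelSet

end CantorSeries

theorem mainTheorem7 (p q : ℕ → ℕ) (hp : IsBasic p) (hq : IsBasic q)
    (w : ℝ) (hw : w ∈ Ioo (0 : ℝ) 1) :
    MeasurableSet (levelSet p q w) ∧
    -- the case of a unique expansion
    (w ∈ uniqueSet q →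
      Tendsto (fun n => ∏ j ∈ Finset.range n, (omega p q w j : ℝ≥0∞) / (p j : ℝ≥0∞)) atTop
        (𝓝 (volume (levelSet p q w))) ∧
      (LogNegligible p →
        dimH (levelSet p q w) =
          liminf (fun n => ENNReal.ofReal
            (Real.log (∏ j ∈ Finset.range n, omega p q w j : ℕ) /
              Real.log (∏ j ∈ Finset.range n, p j : ℕ))) atTop)) ∧
    -- the case of a terminating expansion with the last nonzero digit at the position `M`
    (w ∉ uniqueSet q → ∀ M : ℕ, IsGreatest {t | 0 < digit q w t} M →
      (∀ n, M < n → q n ≤ p n) → digit q w M ≤ p M →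
      Tendsto (fun n => (∏ j ∈ Finset.range M, (omega p q w j : ℝ≥0∞) / (p j : ℝ≥0∞)) *
          (1 / (p M : ℝ≥0∞)) *
          ∏ j ∈ Finset.Ico (M + 1) n, ((p j - q j + 1 : ℕ) : ℝ≥0∞) / (p j : ℝ≥0∞)) atTop
        (𝓝 (volume (levelSet p q w))) ∧
      ((∀ j, j < M → digit q w j < p j) → LogNegligible p →
        dimH (levelSet p q w) =
          liminf (fun n => ENNReal.ofReal
            (Real.log (∏ j ∈ Finset.Ico (M + 1) n, (p j - q j + 1) : ℕ) /
              Real.log (∏ j ∈ Finset.Ico (M + 1) n, p j : ℕ))) atTop)) ∧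
    -- coincidence of the dimensions
    ((levelSet p q w).Nonempty → BalancedCounts p (fun n => (digitSet p q w n).card) →
      dimH (levelSet p q w) = packingDim (levelSet p q w) ∧
      lowerBoxDim (levelSet p q w) = dimH (levelSet p q w) ∧
      upperBoxDim (levelSet p q w) = dimH (levelSet p q w)) := by
  refine ⟨measurableSet_levelSet hp hq hw, fun hU => ⟨?_, fun hneg => ?_⟩,
    fun _ M hM hqp hMp => ⟨?_, fun hlt hneg => ?_⟩, fun _ hbal => ?_⟩
  · have h := tendsto_prod_volume_levelSet (p := p) hp hq hw
    rwa [infDigit_eq_digit hU, ← omega_eq_digitCount] at h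
  · exact dimH_levelSet_of_mem_uniqueSet hp hq hw hU hneg
  · exact tendsto_prod_volume_levelSet_of_isGreatest hp hq hw hM hqp hMp
  · exact dimH_levelSet_of_isGreatest hp hq hw hM hqp hMp hlt hneg
  · exact dims_eq_of_upperBoxDim_le (upperBoxDim_levelSet_le hp hq hw hbal)
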